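/- **Setting.** Let $n,m\ge 1$. On a probability space let $(A_t,B_t,Q_t,R_t)_{t\ge1}$ be independent and identically distributed random tuples of real matrices, $A_t\in\mathbb R^{n\times n}$, $B_t\in\mathbb R^{n\times m}$, $Q_t\in\mathbb R^{n\times n}$, $R_t\in\mathbb R^{m\times m}$ (the four matrices at one time may be dependent), and let $x_0$ be a random vector in $\mathbb R^n$ independent of all of them. Put $\Lambda_t=[A_t\ B_t]$, $N_t=\mathrm{diag}(Q_t,R_t)$, and assume that $N_t$ is almost surely symmetric positive semidefinite; $A,B,Q,R,\Lambda,N$ without index denote the quantities at time $1$. Let $\|\cdot\|$ be the Euclidean norm or the induced operator norm, $\sigma_{\min}$ the smallest singular value, $\bar X=\mathbb E[X]$. For $L\in\mathbb R^{m\times n}$ let $x_{t+1}=(A_{t+1}-B_{t+1}L)x_t$ be the state process under the feedback $u_t=-Lx_t$, and $$C(L)=\mathbb E\Big[\sum_{t\ge0}x_t^\top(Q_{t+1}+L^\top R_{t+1}L)x_t\Big],\qquad \Sigma_L=\mathbb E\Big[\sum_{t\ge0}x_tx_t^\top\Big].$$ Let $\mathcal F_L(X)=\mathbb E[(A-BL)X(A-BL)^\top]$,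 an operator on the real symmetric $n\times n$ matrices, and let $U_{ad}=\{L:\rho(\mathcal F_L)<1\}$, with $\rho$ the spectral radius; these are the admissible (mean-square stabilizing) feedback matrices. **Assumption 1.** $\mathbb E\|x_0\|^2$, $\mathbb E\|N\|$, $\mathbb E\|\Lambda\|^2$ are finite, $\mathbb E[N]$ is positive definite, and $(A,B)$ is mean-square stabilizable, i.e. for some $L$ the process $x_t$ satisfies $\mathbb E[x_t^\top x_t]\to0$. **Assumption 2.** $\Sigma_0=\mathbb E[x_0x_0^\top]$ is positive definite. Write $\mu=\sigma_{\min}(\Sigma_0)$. **Theorem 1.** Under Assumptions 1 and 2, $C$ is finite and differentiable at every point of $U_{ad}$ and has a unique minimizer $L^*$ over $U_{ad}$. There is a constant $c>0$, depending only on $\mathbb E\|A\|^2$, $\mathbb E\|B\|^2$, $\mathbb E\|Q\|$, $\mathbb E\|R\|$, $\sigma_{\min}(\bar Q)$, $\sigma_{\min}(\bar R)$ and $\mu$, such that for every $L_0\in U_{ad}$ and every $\eta$ with $0<\eta\le\eta^*:=c\,(1+C(L_0))^{-5}$ the iteration $L_{k+1}=L_k-\eta\nabla C(L_k)$ (gradient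 with respect to the Frobenius inner product) stays in $U_{ad}$, converges to $L^*$, and satisfies for all $k\ge0$ $$C(L_{k+1})-C(L^*)\le\Big(1-2\eta\frac{\mu^2\sigma_{\min}(\bar R)}{\|\Sigma_{L^*}\|}\Big)\big(C(L_k)-C(L^*)\big).$$ Moreover, for every $\epsilon>0$ and every integer $k\ge1$ with $$k\ge\frac{\|\Sigma_{L^*}\|}{2\eta\mu^2\sigma_{\min}(\bar R)}\log\frac{C(L_0)-C(L^*)}{\epsilon}$$ one has $C(L_k)-C(L^*)<\epsilon$ (if $C(L_0)=C(L^*)$, this holds for every $k\ge1$). -/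

import Mathlib

open MeasureTheory ProbabilityTheory Filter Topology
open scoped Matrix TensorProduct Matrix.Norms.L2Operator

noncomputable section

namespace RandLQ

/-- The entrywise (product) sigma-algebra on matrices. -/
instance instMeasurableSpaceMatrix {ι κ : Type*} : MeasurableSpace (Matrix ι κ ℝ) :=
  inferInstanceAs (MeasurableSpace (ι → κ → ℝ))

/-- Data and standing assumptions of the infinite-horizon linear-quadratic problem with random
parameters: state dimension `n`, control dimension `m`.  The index `t` of `A`, `B`, `Q`, `R`
labels the parameters that act between time `t` and time `t + 1`.
The norm on matrices is the operator norm induced by the Euclidean norms. -/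
structure LQSystem (n m : ℕ) {Ω : Type*} [MeasurableSpace Ω] (P : Measure Ω) where
  /-- initial state -/
  x₀ : Ω → (Fin n → ℝ)
  A : ℕ → Ω → Matrix (Fin n) (Fin n) ℝ
  B : ℕ → Ω → Matrix (Fin n) (Fin m) ℝ
  Q : ℕ → Ω → Matrix (Fin n) (Fin n) ℝ
  R : ℕ → Ω → Matrix (Fin m) (Fin m) ℝ
  measurable_x₀ : Measurable x₀
  measurable_param : ∀ t, Measurable fun ω => (A t ω, B t ω, Q t ω, R t ω)
  /-- the parameters are independent in time (but arbitrarily dependent at each fixed time) -/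
  indep_param : iIndepFun (fun t ω => (A t ω, B t ω, Q t ω, R t ω)) P
  /-- the parameters are identically distributed in time -/
  ident_param : ∀ t, IdentDistrib (fun ω => (A t ω, B t ω, Q t ω, R t ω))
    (fun ω => (A 0 ω, B 0 ω, Q 0 ω, R 0 ω)) P P
  /-- the initial state is independent of all the parameters -/
  indep_x₀ : IndepFun x₀ (fun ω t => (A t ω, B t ω, Q t ω, R t ω)) P
  /-- the cost matrix `N = diag(Q, R)` is (symmetric) positive semidefinite -/
  posSemidef_N : ∀ t, ∀ᵐ ω ∂P, (Matrix.fromBlocks (Q t ω) 0 0 (R t ω)).PosSemidef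
  /-- `E ‖x₀‖² < ∞` -/
  integrable_x₀ : Integrable (fun ω => x₀ ω ⬝ᵥ x₀ ω) P
  /-- `E ‖N‖ < ∞` -/
  integrable_N : Integrable (fun ω => ‖Matrix.fromBlocks (Q 0 ω) 0 0 (R 0 ω)‖) P
  /-- `E ‖Λ‖² < ∞`, where `Λ = [A B]` -/
  integrable_Λ : Integrable (fun ω => ‖Matrix.fromCols (A 0 ω) (B 0 ω)‖ ^ 2) P

/-- Entrywise expectation of a random matrix. -/
def expect {Ω : Type*} [MeasurableSpace Ω] (P : Measure Ω) {ι κ : Type*}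
    (X : Ω → Matrix ι κ ℝ) : Matrix ι κ ℝ :=
  Matrix.of fun i j => ∫ ω, X ω i j ∂P

/-- The smallest singular value of a (nonempty) matrix; Mathlib lists the singular values in
decreasing order, starting with index `0`. -/
def sigmaMin {r c : ℕ} (M : Matrix (Fin r) (Fin c) ℝ) : ℝ :=
  (Matrix.toEuclideanLin M).singularValues (min r c - 1)

/-- The space of real symmetric `n × n` matrices. -/
def symMat (n : ℕ) : Submodule ℝ (Matrix (Fin n) (Fin n) ℝ) where
  carrier := {X | X.IsSymm}
  add_mem' := fun ha hb => ha.add hb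
  zero_mem' := Matrix.isSymm_zero
  smul_mem' := fun c _ hx => hx.smul c

/-- The spectral radius of a linear operator on a real vector space: that of its
complexification. -/
def specRad {V : Type*} [AddCommGroup V] [Module ℝ V] (T : V →ₗ[ℝ] V) : ENNReal :=
  spectralRadius ℂ (T.baseChange ℂ : Module.End ℂ (ℂ ⊗[ℝ] V))

/-- The gradient, for the Frobenius inner product, of a function of a matrix: the matrix of its
partial derivatives. -/
def gradient {m n : ℕ} (f : Matrix (Fin m) (Fin n) ℝ → ℝ) (L : Matrix (Fin m) (Fin n) ℝ) :
    Matrix (Fin m) (Fin n) ℝ :=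
  Matrix.of fun i j => fderiv ℝ f L (Matrix.single i j 1)

namespace LQSystem

variable {n m : ℕ} {Ω : Type*} [MeasurableSpace Ω] {P : Measure Ω} (S : LQSystem n m P)

/-- `Λ = [A B]`. -/
def Λ (t : ℕ) (ω : Ω) : Matrix (Fin n) (Fin n ⊕ Fin m) ℝ :=
  Matrix.fromCols (S.A t ω) (S.B t ω)

/-- `N = diag(Q, R)`. -/
def N (t : ℕ) (ω : Ω) : Matrix (Fin n ⊕ Fin m) (Fin n ⊕ Fin m) ℝ :=
  Matrix.fromBlocks (S.Q t ω) 0 0 (S.R t ω)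

/-- The state process under the linear feedback `u = -L x`. -/
def state (L : Matrix (Fin m) (Fin n) ℝ) : ℕ → Ω → (Fin n → ℝ)
  | 0, ω => S.x₀ ω
  | t + 1, ω => S.Λ t ω *ᵥ Sum.elim (state L t ω) (-(L *ᵥ state L t ω))

/-- The cost paid at time `t` under the linear feedback `u = -L x`. -/
def stageCost (L : Matrix (Fin m) (Fin n) ℝ) (t : ℕ) (ω : Ω) : ℝ :=
  Sum.elim (S.state L t ω) (-(L *ᵥ S.state L t ω)) ⬝ᵥ
    (S.N t ω *ᵥ Sum.elim (S.state L t ω) (-(L *ᵥ S.state L t ω)))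

/-- The expected total cost as an extended number (the stage costs are almost surely
nonnegative). -/
def ecost (L : Matrix (Fin m) (Fin n) ℝ) : ENNReal :=
  ∫⁻ ω, ∑' t, ENNReal.ofReal (S.stageCost L t ω) ∂P

/-- The cost `C(L)`, as a real number. -/
def cost (L : Matrix (Fin m) (Fin n) ℝ) : ℝ := (S.ecost L).toReal

/-- `L` mean-square stabilizes the system: `E[xₜᵀ xₜ] → 0`. -/
def MeanSquareStabilizing (L : Matrix (Fin m) (Fin n) ℝ) : Prop :=
  Tendsto (fun t => ∫⁻ ω, ENNReal.ofReal (S.state L t ω ⬝ᵥ S.state L t ω) ∂P) atTop (𝓝 0)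

/-- `(A, B)` is mean-square stabilizable. -/
def MeanSquareStabilizable : Prop := ∃ L, S.MeanSquareStabilizing L

/-- The closed-loop matrix `A - B L`. -/
def closedLoop (L : Matrix (Fin m) (Fin n) ℝ) (ω : Ω) : Matrix (Fin n) (Fin n) ℝ :=
  S.A 0 ω - S.B 0 ω * L

theorem abs_entry_le_norm {ι κ : Type*} [Fintype ι] [Fintype κ] [DecidableEq κ]
    (M : Matrix ι κ ℝ) (i : ι) (j : κ) : |M i j| ≤ ‖M‖ := by
  have h := Matrix.l2_opNorm_mulVec M (EuclideanSpace.single j (1 : ℝ))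
  have h2 := PiLp.norm_apply_le
    ((EuclideanSpace.equiv ι ℝ).symm (M *ᵥ (EuclideanSpace.single j (1 : ℝ)).ofLp)) i
  have h3 : ((EuclideanSpace.equiv ι ℝ).symm
      (M *ᵥ (EuclideanSpace.single j (1 : ℝ)).ofLp)).ofLp i = M i j := by
    simp [Matrix.mulVec_single]
  rw [h3, Real.norm_eq_abs] at h2
  rw [PiLp.norm_single, norm_one, mul_one] at h
  exact h2.trans h

theorem measurable_entry {ι κ : Type*} (i : ι) (j : κ) :
    Measurable fun M : Matrix ι κ ℝ => M i j :=
  (measurable_pi_apply j).comp (measurable_pi_apply (X := fun _ : ι => κ → ℝ) i)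

theorem memLp_param (i : Fin n) (j : Fin n ⊕ Fin m) : MemLp (fun ω => S.Λ 0 ω i j) 2 P := by
  have hm : Measurable fun ω => S.Λ 0 ω i j := by
    cases j with
    | inl j => exact (measurable_entry i j).comp (S.measurable_param 0).fst
    | inr j => exact (measurable_entry i j).comp (S.measurable_param 0).snd.fst
  rw [memLp_two_iff_integrable_sq hm.aestronglyMeasurable]
  refine S.integrable_Λ.mono' (hm.pow_const 2).aestronglyMeasurable (ae_of_all _ fun ω => ?_)
  rw [Real.norm_eq_abs, abs_pow]
  exact pow_le_pow_left₀ (abs_nonneg _) (abs_entry_le_norm _ i j) 2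

theorem memLp_closedLoop (L : Matrix (Fin m) (Fin n) ℝ) (i j : Fin n) :
    MemLp (fun ω => S.closedLoop L ω i j) 2 P := by
  have h1 := S.memLp_param i (Sum.inl j)
  have h2 : MemLp (fun ω => ∑ k, L k j * S.Λ 0 ω i (Sum.inr k)) 2 P :=
    memLp_finsetSum _ fun k _ => (S.memLp_param i (Sum.inr k)).const_mul (L k j)
  refine (h1.sub h2).ae_eq (ae_of_all _ fun ω => ?_)
  simp [closedLoop, Λ, Matrix.mul_apply, mul_comm]

theorem integrable_sandwich (L : Matrix (Fin m) (Fin n) ℝ) (X : Matrix (Fin n) (Fin n) ℝ)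
    (i j : Fin n) :
    Integrable (fun ω => (S.closedLoop L ω * X * (S.closedLoop L ω)ᵀ) i j) P := by
  simp only [Matrix.mul_apply, Matrix.transpose_apply, Finset.sum_mul]
  refine integrable_finsetSum _ fun k _ => integrable_finsetSum _ fun l _ => ?_
  refine (((S.memLp_closedLoop L i l).integrable_mul
    (S.memLp_closedLoop L j k)).mul_const (X l k)).congr (ae_of_all _ fun ω => ?_)
  simp only [Pi.mul_apply]
  ring

/-- The operator `F_L(X) = E[(A - B L) X (A - B L)ᵀ]` on symmetric matrices. -/
def covOp (L : Matrix (Fin m) (Fin n) ℝ) : symMat n →ₗ[ℝ] symMat n where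
  toFun X := ⟨expect P fun ω =>
      S.closedLoop L ω * (X : Matrix (Fin n) (Fin n) ℝ) * (S.closedLoop L ω)ᵀ, by
    have hX : (X : Matrix (Fin n) (Fin n) ℝ)ᵀ = X := X.2
    change Matrix.transpose _ = _
    ext i j
    simp only [expect, Matrix.transpose_apply, Matrix.of_apply]
    congr 1
    ext ω
    rw [← Matrix.transpose_apply (_ * _)]
    simp only [Matrix.transpose_mul, Matrix.transpose_transpose, hX, Matrix.mul_assoc]⟩
  map_add' X Y := by
    ext i j
    have h := integral_add (S.integrable_sandwich L X i j) (S.integrable_sandwich L Y i j)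
    simpa [expect, Matrix.mul_add, Matrix.add_mul] using h
  map_smul' c X := by
    ext i j
    have h := integral_const_mul (μ := P) c
      (fun ω => (S.closedLoop L ω * X.1 * (S.closedLoop L ω)ᵀ) i j)
    simpa [expect] using h

/-- The set `U_ad` of admissible feedback matrices. -/
def admissible : Set (Matrix (Fin m) (Fin n) ℝ) := {L | specRad (S.covOp L) < 1}

/-- `E[N]` is positive definite and `(A, B)` is mean-square stabilizable (the integrability
requirements are part of `LQSystem`). -/
def Assumption1 : Prop := (expect P (S.N 0)).PosDef ∧ S.MeanSquareStabilizable

/-- The initial second moment matrix `Σ₀ = E[x₀ x₀ᵀ]`. -/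
def covInit : Matrix (Fin n) (Fin n) ℝ :=
  expect P fun ω => Matrix.vecMulVec (S.x₀ ω) (S.x₀ ω)

/-- `Σ₀` is positive definite. -/
def Assumption2 : Prop := S.covInit.PosDef

/-- The aggregate state second moment matrix `Σ_L = E[∑ₜ xₜ xₜᵀ]`. -/
def covAgg (L : Matrix (Fin m) (Fin n) ℝ) : Matrix (Fin n) (Fin n) ℝ :=
  Matrix.of fun i j => ∫ ω, ∑' t, S.state L t ω i * S.state L t ω j ∂P

/-- `μ`, the smallest singular value of `Σ₀`. -/
def mu : ℝ := sigmaMin S.covInit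

/-- The smallest singular value of `E[Q]`. -/
def sigmaQ : ℝ := sigmaMin (expect P (S.Q 0))

/-- The smallest singular value of `E[R]`. -/
def sigmaR : ℝ := sigmaMin (expect P (S.R 0))

/-- `L` is optimal: it minimizes `C` over the admissible set. -/
def IsOptimal (L : Matrix (Fin m) (Fin n) ℝ) : Prop :=
  L ∈ S.admissible ∧ ∀ L' ∈ S.admissible, S.cost L ≤ S.cost L'

/-- The exact policy gradient iteration `L_{k+1} = L_k - η ∇C(L_k)`. -/
def gdIter (η : ℝ) (L₀ : Matrix (Fin m) (Fin n) ℝ) : ℕ → Matrix (Fin m) (Fin n) ℝ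
  | 0 => L₀
  | k + 1 => gdIter η L₀ k - η • gradient S.cost (gdIter η L₀ k)

end LQSystem

end RandLQ

end

/-!
The proof first removes the randomness. The state `xₜ` is a function of `x₀` and of the parameters
before time `t`, hence independent of the parameters at time `t` (`LQSystem.indepFun_state`).
Therefore `E[xₜ xₜᵀ] = F_L ^ t Σ₀` (`LQSystem.cov_eq`), and the cost and the aggregate second moment
are the trace of a Neumann series and the series itself (`LQSystem.cost_eq`, `LQSystem.covAgg_eq`).
By Gelfand's formula admissibility is the same as summability of `F_L ^ t 1`
(`LQSystem.admissible_iff_stable`).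

What is left concerns the positive map `Φ X = E[Λ X Λᵀ]` and its trace adjoint, collected in
`MomentModel`. With the value matrix `P`, the solution of `P = Q + Lᵀ R L + F_L* P`, and the
residual `E = E[(R + Bᵀ P B) L - Bᵀ P A]`, the cost satisfies the exact identity
`C(L + Δ) - C(L) = 2 tr (Σ' Δᵀ E) + tr (Σ' Δᵀ (R + E[Bᵀ P B]) Δ)` with `Σ' = Σ_{L + Δ}`
(`MomentModel.Stable.cost_sub`). Everything follows from it.

* Completing the square gives gradient domination (`MomentModel.Stable.gradient_dominated`) with
  the constant that appears in the rate.
* A Lyapunov argument shows that `Σ_L` certifies stability of `L + Δ` for small `Δ`, and that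
  `Σ_{L + Δ}` is then close to `Σ_L` (`MomentModel.Stable.perturb`). All estimates are inequalities
  in the Loewner order, so they do not involve the dimensions. They yield differentiability with
  gradient `2 E Σ_L`, and the decrease of the cost along a gradient step by `η / 2` times the
  squared norm of the gradient (`MomentModel.Stable.descent`). Combined with domination this is the
  claimed contraction.
* The radius of stability is uniform on sublevel sets of the cost, so these are compact and a
  minimizer exists. Its residual vanishes, and the identity turns into quadratic growth
  (`MomentModel.quadratic_growth`), which gives uniqueness and the convergence of the iterates.
-/

set_option linter.unusedSectionVars false

namespace RandLQ

/-! ### The Loewner order on real symmetric matrices -/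

section Loewner

open scoped MatrixOrder

variable {n m : Type*} [Fintype n] [Fintype m] [DecidableEq n] [DecidableEq m]

theorem nonneg_iff_quadForm {A : Matrix n n ℝ} :
    0 ≤ A ↔ A.IsSymm ∧ ∀ v, 0 ≤ v ⬝ᵥ (A *ᵥ v) := by
  rw [Matrix.nonneg_iff_posSemidef, Matrix.posSemidef_iff_dotProduct_mulVec]
  simp [Matrix.IsHermitian, Matrix.IsSymm, Matrix.conjTranspose_eq_transpose_of_trivial]

theorem isSymm_of_nonneg {A : Matrix n n ℝ} (hA : 0 ≤ A) : A.IsSymm :=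
  (nonneg_iff_quadForm.1 hA).1

theorem exists_eq_transpose_mul_self {A : Matrix n n ℝ} (hA : 0 ≤ A) :
    ∃ C : Matrix n n ℝ, A = Cᵀ * C := by
  obtain ⟨C, hC⟩ := CStarAlgebra.nonneg_iff_eq_star_mul_self.1 hA
  exact ⟨C, by rw [hC, Matrix.star_eq_conjTranspose,
    Matrix.conjTranspose_eq_transpose_of_trivial]⟩

theorem conj_nonneg {A : Matrix n n ℝ} (hA : 0 ≤ A) (K : Matrix m n ℝ) : 0 ≤ K * A * Kᵀ := by
  rw [Matrix.nonneg_iff_posSemidef] at *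
  simpa [Matrix.conjTranspose_eq_transpose_of_trivial] using hA.mul_mul_conjTranspose_same K

theorem conj_mono {A B : Matrix n n ℝ} (h : A ≤ B) (K : Matrix m n ℝ) :
    K * A * Kᵀ ≤ K * B * Kᵀ := by
  have := conj_nonneg (sub_nonneg.2 h) K
  rw [Matrix.mul_sub, Matrix.sub_mul] at this
  exact sub_nonneg.1 this

theorem conj_transpose_mono {A B : Matrix n n ℝ} (h : A ≤ B) (K : Matrix n m ℝ) :
    Kᵀ * A * K ≤ Kᵀ * B * K := by
  simpa using conj_mono h Kᵀ

theorem mul_transpose_nonneg (K : Matrix m n ℝ) : 0 ≤ K * Kᵀ := by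
  simpa using conj_nonneg (Matrix.nonneg_iff_posSemidef.2 Matrix.PosSemidef.one) K

theorem transpose_mul_nonneg (K : Matrix m n ℝ) : 0 ≤ Kᵀ * K := by
  simpa using mul_transpose_nonneg Kᵀ

theorem one_nonneg_matrix : (0 : Matrix n n ℝ) ≤ 1 :=
  Matrix.nonneg_iff_posSemidef.2 Matrix.PosSemidef.one

theorem trace_nonneg_of_nonneg {A : Matrix n n ℝ} (hA : 0 ≤ A) : 0 ≤ A.trace :=
  (Matrix.nonneg_iff_posSemidef.1 hA).trace_nonneg

theorem trace_mono {A B : Matrix n n ℝ} (h : A ≤ B) : A.trace ≤ B.trace := by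
  have := trace_nonneg_of_nonneg (sub_nonneg.2 h)
  rw [Matrix.trace_sub] at this
  linarith

theorem trace_mul_nonneg {A B : Matrix n n ℝ} (hA : 0 ≤ A) (hB : 0 ≤ B) : 0 ≤ (A * B).trace := by
  obtain ⟨C, rfl⟩ := exists_eq_transpose_mul_self hB
  rw [← Matrix.mul_assoc, Matrix.trace_mul_comm, ← Matrix.mul_assoc]
  exact trace_nonneg_of_nonneg (conj_nonneg hA C)

theorem trace_mul_mono_left {A A' B : Matrix n n ℝ} (h : A ≤ A') (hB : 0 ≤ B) :
    (A * B).trace ≤ (A' * B).trace := by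
  have := trace_mul_nonneg (sub_nonneg.2 h) hB
  rw [Matrix.sub_mul, Matrix.trace_sub] at this
  linarith

theorem trace_mul_mono_right {A B B' : Matrix n n ℝ} (hA : 0 ≤ A) (h : B ≤ B') :
    (A * B).trace ≤ (A * B').trace := by
  have := trace_mul_nonneg hA (sub_nonneg.2 h)
  rw [Matrix.mul_sub, Matrix.trace_sub] at this
  linarith

theorem smul_nonneg_matrix {A : Matrix n n ℝ} {c : ℝ} (hc : 0 ≤ c) (hA : 0 ≤ A) : 0 ≤ c • A := by
  rw [Matrix.nonneg_iff_posSemidef] at *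
  exact hA.smul hc

theorem smul_mono_matrix {A B : Matrix n n ℝ} {c : ℝ} (hc : 0 ≤ c) (h : A ≤ B) :
    c • A ≤ c • B := by
  have := smul_nonneg_matrix hc (sub_nonneg.2 h)
  rw [smul_sub] at this
  exact sub_nonneg.1 this

theorem smul_mono_scalar {A : Matrix n n ℝ} {c d : ℝ} (hA : 0 ≤ A) (h : c ≤ d) :
    c • A ≤ d • A := by
  have := smul_nonneg_matrix (sub_nonneg.2 h) hA
  rw [sub_smul] at this
  exact sub_nonneg.1 this

/-- To bound a symmetric matrix by a multiple of the identity it suffices to bound its quadratic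
form. -/
theorem le_smul_one_of_quadForm {A : Matrix n n ℝ} {c : ℝ} (hA : A.IsSymm)
    (h : ∀ v, v ⬝ᵥ (A *ᵥ v) ≤ c * (v ⬝ᵥ v)) : A ≤ c • 1 := by
  rw [← sub_nonneg, nonneg_iff_quadForm]
  refine ⟨(Matrix.isSymm_one.smul c).sub hA, fun v => ?_⟩
  have := h v
  simp only [Matrix.sub_mulVec, Matrix.smul_mulVec, Matrix.one_mulVec, dotProduct_sub,
    dotProduct_smul, smul_eq_mul]
  linarith

theorem quadForm_conj (A : Matrix n n ℝ) (K : Matrix n m ℝ) (v : m → ℝ) :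
    v ⬝ᵥ ((Kᵀ * A * K) *ᵥ v) = (K *ᵥ v) ⬝ᵥ (A *ᵥ (K *ᵥ v)) := by
  rw [← Matrix.mulVec_mulVec, ← Matrix.mulVec_mulVec, Matrix.dotProduct_mulVec,
    Matrix.vecMul_transpose]

theorem trace_transpose_mul_self (C : Matrix m n ℝ) : (Cᵀ * C).trace = ∑ i, ∑ j, C i j ^ 2 := by
  simp only [Matrix.trace, Matrix.diag, Matrix.mul_apply, Matrix.transpose_apply]
  rw [Finset.sum_comm]
  simp [sq]

theorem sq_apply_le_trace (C : Matrix m n ℝ) (i : m) (j : n) : C i j ^ 2 ≤ (Cᵀ * C).trace := by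
  rw [trace_transpose_mul_self]
  exact (Finset.single_le_sum (f := fun j => C i j ^ 2) (fun _ _ => sq_nonneg _)
    (Finset.mem_univ j)).trans (Finset.single_le_sum (f := fun i => ∑ j, C i j ^ 2)
      (fun _ _ => Finset.sum_nonneg fun _ _ => sq_nonneg _) (Finset.mem_univ i))

theorem eq_zero_of_trace_nonpos {C : Matrix m n ℝ} (h : (Cᵀ * C).trace ≤ 0) : C = 0 := by
  ext i j
  have := (sq_apply_le_trace C i j).trans h
  exact pow_eq_zero_iff two_ne_zero |>.1 (le_antisymm this (sq_nonneg _))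

theorem eq_of_trace_sub_nonpos {A B : Matrix m n ℝ} (h : ((A - B)ᵀ * (A - B)).trace ≤ 0) :
    A = B :=
  sub_eq_zero.1 (eq_zero_of_trace_nonpos h)

theorem transpose_mul_self_le (C : Matrix m n ℝ) : Cᵀ * C ≤ (Cᵀ * C).trace • 1 := by
  refine le_smul_one_of_quadForm (isSymm_of_nonneg (transpose_mul_nonneg C)) fun v => ?_
  rw [trace_transpose_mul_self, ← Matrix.mulVec_mulVec, Matrix.dotProduct_mulVec,
    Matrix.vecMul_transpose, Finset.sum_mul]
  refine Finset.sum_le_sum fun i _ => ?_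
  have := Finset.sum_mul_sq_le_sq_mul_sq Finset.univ (C i) v
  simp only [Matrix.mulVec, dotProduct, ← sq]
  exact this

theorem mul_transpose_self_le (C : Matrix m n ℝ) : C * Cᵀ ≤ (Cᵀ * C).trace • 1 := by
  have := transpose_mul_self_le Cᵀ
  rwa [Matrix.transpose_transpose, Matrix.trace_mul_comm C] at this

theorem le_trace_smul_one {A : Matrix n n ℝ} (hA : 0 ≤ A) : A ≤ A.trace • 1 := by
  obtain ⟨C, rfl⟩ := exists_eq_transpose_mul_self hA
  exact transpose_mul_self_le C

theorem abs_apply_le_trace {A : Matrix n n ℝ} (hA : 0 ≤ A) (i j : n) : |A i j| ≤ A.trace := by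
  obtain ⟨hs, hv⟩ := nonneg_iff_quadForm.1 hA
  have hsym : A j i = A i j := congrFun (congrFun hs i) j
  have hd : ∀ k, 0 ≤ A k k := fun k => (Matrix.nonneg_iff_posSemidef.1 hA).diag_nonneg
  have ht : ∀ k, A k k ≤ A.trace := fun k =>
    Finset.single_le_sum (f := fun k => A k k) (fun k _ => hd k) (Finset.mem_univ k)
  have h1 := hv (Pi.single i 1 + Pi.single j 1)
  have h2 := hv (Pi.single i 1 - Pi.single j 1)
  simp only [Matrix.mulVec_add, Matrix.mulVec_sub, Matrix.mulVec_single_one, add_dotProduct,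
    sub_dotProduct, dotProduct_add, dotProduct_sub, single_dotProduct, Matrix.col_apply,
    one_mul, hsym] at h1 h2
  have := ht i
  have := ht j
  rw [abs_le]
  constructor <;> linarith

/-- If `-ζ ≤ Z ≤ ζ`, then the bilinear form `(M, H) ↦ tr (M Z Hᵀ)` is bounded by `ζ` times the
product of Frobenius norms; the product is split by a weight `α`. -/
theorem trace_mul_mul_transpose_le {Z : Matrix n n ℝ} {ζ α : ℝ} (hα : 0 < α)
    (h1 : Z ≤ ζ • 1) (h2 : -(ζ • 1) ≤ Z) (M H : Matrix m n ℝ) :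
    |(M * Z * Hᵀ).trace| ≤
      ζ / (2 * α) * (α ^ 2 * (Mᵀ * M).trace + (Hᵀ * H).trace) := by
  have hZ : Z.IsSymm := by
    have : Z = ζ • 1 - (ζ • 1 - Z) := by abel
    rw [this]
    exact (Matrix.isSymm_one.smul ζ).sub (isSymm_of_nonneg (sub_nonneg.2 h1))
  have key : ∀ W : Matrix m n ℝ, (W * Z * Wᵀ).trace ≤ ζ * (Wᵀ * W).trace ∧
      -(ζ * (Wᵀ * W).trace) ≤ (W * Z * Wᵀ).trace := by
    intro W
    have a := trace_mono (conj_mono h1 W)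
    have b := trace_mono (conj_mono h2 W)
    simp only [Matrix.mul_neg, Matrix.neg_mul, Matrix.trace_neg, Matrix.mul_smul, Matrix.mul_one,
      Matrix.smul_mul, Matrix.trace_smul, smul_eq_mul, Matrix.trace_mul_comm W Wᵀ] at a b
    exact ⟨a, b⟩
  have hsw : (H * Z * Mᵀ).trace = (M * Z * Hᵀ).trace := by
    rw [← Matrix.trace_transpose]
    simp [Matrix.transpose_mul, hZ.eq, Matrix.mul_assoc]
  have hsw' : (Hᵀ * M).trace = (Mᵀ * H).trace := by
    rw [← Matrix.trace_transpose]
    simp [Matrix.transpose_mul]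
  obtain ⟨a1, a2⟩ := key (α • M + H)
  obtain ⟨b1, b2⟩ := key (α • M - H)
  simp only [Matrix.transpose_add, Matrix.transpose_sub, Matrix.transpose_smul, Matrix.add_mul,
    Matrix.mul_add, Matrix.sub_mul, Matrix.mul_sub, Matrix.smul_mul, Matrix.mul_smul,
    Matrix.trace_add, Matrix.trace_sub, Matrix.trace_smul, smul_eq_mul, hsw, hsw'] at a1 a2 b1 b2
  rw [div_mul_eq_mul_div, le_div_iff₀ (by positivity)]
  rw [← abs_of_pos (show 0 < 2 * α by positivity), ← abs_mul, abs_le]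
  constructor <;> nlinarith

end Loewner

/-! ### Spectral radius and powers of a linear operator -/

section SpectralRadius

variable {V : Type*} [AddCommGroup V] [Module ℝ V] {ι : Type*} [Fintype ι] [DecidableEq ι]

/-- The spectral radius can be computed in a basis, where the complex matrices form a Banach
algebra. -/
theorem specRad_eq_spectralRadius_toMatrix (b : Module.Basis ι ℝ V) (T : V →ₗ[ℝ] V) :
    specRad T = spectralRadius ℂ ((LinearMap.toMatrix b b T).map (algebraMap ℝ ℂ)) := by
  have h := LinearMap.toMatrix_baseChange (A := ℂ) T b b
  rw [← h]
  unfold specRad spectralRadius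
  have h2 := AlgEquiv.spectrum_eq (LinearMap.toMatrixAlgEquiv (Algebra.TensorProduct.basis ℂ b))
    (T.baseChange ℂ : Module.End ℂ (ℂ ⊗[ℝ] V))
  change spectrum ℂ (LinearMap.toMatrix _ _ _) = _ at h2
  rw [h2]

/-- Gelfand's formula: the powers of an operator of spectral radius less than one are summable. -/
theorem summable_toMatrix_pow_of_specRad_lt_one (b : Module.Basis ι ℝ V) (T : V →ₗ[ℝ] V)
    (h : specRad T < 1) : ∀ i j, Summable fun t : ℕ => LinearMap.toMatrix b b (T ^ t) i j := by
  intro i j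
  rw [specRad_eq_spectralRadius_toMatrix b] at h
  set M := (LinearMap.toMatrix b b T).map (algebraMap ℝ ℂ) with hM
  have hg := spectrum.pow_nnnorm_pow_one_div_tendsto_nhds_spectralRadius M
  obtain ⟨r, hr1, hr2⟩ := exists_between h
  have hev := hg.eventually (gt_mem_nhds hr1)
  have hr : r ≠ ⊤ := (hr2.trans ENNReal.one_lt_top).ne
  lift r to NNReal using hr
  have hr2' : (r : ℝ) < 1 := by exact_mod_cast hr2
  have hsum : Summable fun t : ℕ => (r : ℝ) ^ t := summable_geometric_of_lt_one r.2 hr2'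
  have hpow : ∀ t : ℕ, (M ^ t) i j = (LinearMap.toMatrix b b (T ^ t) i j : ℝ) := by
    intro t
    rw [hM, ← Matrix.map_pow, ← LinearMap.toMatrix_pow]
    simp
  refine Summable.of_norm_bounded_eventually_nat hsum ?_
  filter_upwards [hev, eventually_gt_atTop 0] with t ht ht0
  have h1 : (‖M ^ t‖₊ : ENNReal) ≤ (r : ENNReal) ^ t := by
    have := ENNReal.rpow_le_rpow ht.le (z := (t : ℝ)) (by positivity)
    rw [← ENNReal.rpow_mul, one_div, inv_mul_cancel₀ (by positivity), ENNReal.rpow_one,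
      ENNReal.rpow_natCast] at this
    exact this
  have h2 : ‖M ^ t‖ ≤ (r : ℝ) ^ t := by exact_mod_cast h1
  refine le_trans ?_ h2
  have h3 : ‖(M ^ t) i j‖ = ‖LinearMap.toMatrix b b (T ^ t) i j‖ := by
    rw [hpow]; simp
  rw [← h3]
  have h := Matrix.l2_opNorm_mulVec (M ^ t) (EuclideanSpace.single j (1 : ℂ))
  have h2 := PiLp.norm_apply_le
    ((EuclideanSpace.equiv ι ℂ).symm ((M ^ t) *ᵥ (EuclideanSpace.single j (1 : ℂ)).ofLp)) i
  have h3 : ((EuclideanSpace.equiv ι ℂ).symm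
      ((M ^ t) *ᵥ (EuclideanSpace.single j (1 : ℂ)).ofLp)).ofLp i = (M ^ t) i j := by
    simp [Matrix.mulVec_single]
  rw [h3] at h2
  rw [PiLp.norm_single, norm_one, mul_one] at h
  exact h2.trans h

/-- If the powers of an operator tend to zero, some power has norm less than one, which bounds the
spectral radius. -/
theorem specRad_lt_one_of_tendsto (b : Module.Basis ι ℝ V) (T : V →ₗ[ℝ] V)
    (h : ∀ i j, Tendsto (fun t : ℕ => LinearMap.toMatrix b b (T ^ t) i j) atTop (𝓝 0)) :
    specRad T < 1 := by
  rw [specRad_eq_spectralRadius_toMatrix b]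
  set M := (LinearMap.toMatrix b b T).map (algebraMap ℝ ℂ) with hM
  have hpow : ∀ (t : ℕ) i j, (M ^ t) i j = (LinearMap.toMatrix b b (T ^ t) i j : ℝ) := by
    intro t i j
    rw [hM, ← Matrix.map_pow, ← LinearMap.toMatrix_pow]
    simp
  have hM0 : Tendsto (fun t : ℕ => M ^ t) atTop (𝓝 0) := by
    refine tendsto_pi_nhds.2 fun i => tendsto_pi_nhds.2 fun j => ?_
    simp only [hpow]
    simpa [Function.comp_def] using (Complex.continuous_ofReal.tendsto 0).comp (h i j)
  obtain ⟨t, ht⟩ := ((hM0.comp (tendsto_add_atTop_nat 1)).norm.eventually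
    (gt_mem_nhds (show ‖(0 : Matrix ι ι ℂ)‖ < 1 by simp))).exists
  have ht1 : ‖M ^ (t + 1)‖ < 1 := ht
  rcases isEmpty_or_nonempty ι with hι | hι
  · have : Subsingleton (Matrix ι ι ℂ) := inferInstance
    simp
  refine (spectrum.spectralRadius_le_pow_nnnorm_pow_one_div ℂ M t).trans_lt ?_
  have h1 : (‖(1 : Matrix ι ι ℂ)‖₊ : ENNReal) = 1 := by simp
  rw [h1, ENNReal.one_rpow, mul_one]
  refine ENNReal.rpow_lt_one ?_ (by positivity)
  exact_mod_cast ht1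

end SpectralRadius

/-! ### Deterministic second moment models, stability and fixed points -/

section
open scoped MatrixOrder

section Limits

variable {n : Type*} [Fintype n] [DecidableEq n]

theorem nonneg_of_tendsto {A : ℕ → Matrix n n ℝ} {B : Matrix n n ℝ}
    (hA : ∀ t, 0 ≤ A t) (h : Tendsto A atTop (𝓝 B)) : 0 ≤ B := by
  have he : ∀ i j, Tendsto (fun t => A t i j) atTop (𝓝 (B i j)) := fun i j =>
    tendsto_pi_nhds.1 (tendsto_pi_nhds.1 h i) j
  rw [nonneg_iff_quadForm]
  refine ⟨?_, fun v => ?_⟩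
  · ext i j
    refine tendsto_nhds_unique (l := atTop) (he j i) ((he i j).congr fun t => ?_)
    exact (congrFun (congrFun (isSymm_of_nonneg (hA t)) i) j).symm
  · refine ge_of_tendsto' (x := atTop) (f := fun t => v ⬝ᵥ (A t *ᵥ v)) ?_
      fun t => (nonneg_iff_quadForm.1 (hA t)).2 v
    simp only [Matrix.mulVec, dotProduct]
    exact tendsto_finsetSum _ fun i _ => (tendsto_finsetSum _ fun j _ =>
      (he i j).mul_const _).const_mul _

theorem summable_matrix_of_trace {A : ℕ → Matrix n n ℝ} (hA : ∀ t, 0 ≤ A t)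
    (h : Summable fun t => (A t).trace) : Summable A :=
  Pi.summable.2 fun i => Pi.summable.2 fun j =>
    Summable.of_norm_bounded h fun t => abs_apply_le_trace (hA t) i j

theorem tsum_nonneg_matrix {A : ℕ → Matrix n n ℝ} (hA : ∀ t, 0 ≤ A t) (h : Summable A) :
    0 ≤ ∑' t, A t :=
  nonneg_of_tendsto (fun _ => Finset.sum_nonneg fun t _ => hA t) h.hasSum.tendsto_sum_nat

theorem exists_add_smul_one_nonneg {U : Matrix n n ℝ} (hU : U.IsSymm) :
    ∃ c : ℝ, 0 ≤ U + c • 1 := by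
  refine ⟨((Uᵀ * U).trace + 1) / 2, ?_⟩
  have h1 := transpose_mul_nonneg (U + 1)
  have h2 := sub_nonneg.2 (transpose_mul_self_le U)
  have h3 := smul_nonneg_matrix (show (0 : ℝ) ≤ 1 / 2 by norm_num) (add_nonneg h1 h2)
  convert h3 using 1
  simp only [Matrix.transpose_add, hU.eq, Matrix.transpose_one, Matrix.add_mul, Matrix.mul_add,
    Matrix.one_mul, Matrix.mul_one]
  module

/-- The Neumann series of `T` at `x` solves `y = x + T y`. -/
theorem tsum_pow_apply_eq {V : Type*} [AddCommGroup V] [Module ℝ V] [TopologicalSpace V]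
    [IsTopologicalAddGroup V] [ContinuousSMul ℝ V] [T2Space V] [FiniteDimensional ℝ V]
    (T : V →ₗ[ℝ] V) (x : V) (h : Summable fun t : ℕ => (T ^ t) x) :
    ∑' t : ℕ, (T ^ t) x = x + T (∑' t : ℕ, (T ^ t) x) := by
  have h1 := (LinearMap.toContinuousLinearMap T).map_tsum h
  simp only [LinearMap.coe_toContinuousLinearMap'] at h1
  rw [h1, h.tsum_eq_zero_add]
  simp [pow_succ']

end Limits

/-- The data of a linear-quadratic problem with random parameters that survive after taking
expectations: the map `Φ X = E[Λ X Λᵀ]` on second moment matrices, its trace adjoint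
`G P = E[Λᵀ P Λ]`, the mean cost matrices `Q`, `R`, the initial second moment `X₀`, together with
bounds in the Loewner order: `sQ`, `sR`, `mu` are lower bounds for `Q`, `R`, `X₀`, while `r` and `b`
are upper bounds for `R` and for the second moments `E[B Bᵀ]` and `E[Bᵀ B]` of the input matrix. -/
structure MomentModel (n m : Type*) [Fintype n] [Fintype m] [DecidableEq n] [DecidableEq m] where
  Φ : Matrix (n ⊕ m) (n ⊕ m) ℝ →ₗ[ℝ] Matrix n n ℝ
  G : Matrix n n ℝ →ₗ[ℝ] Matrix (n ⊕ m) (n ⊕ m) ℝ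
  Q : Matrix n n ℝ
  R : Matrix m m ℝ
  X₀ : Matrix n n ℝ
  sQ : ℝ
  sR : ℝ
  mu : ℝ
  b : ℝ
  r : ℝ
  trace_G_mul : ∀ P X, (G P * X).trace = (P * Φ X).trace
  Φ_nonneg : ∀ X, 0 ≤ X → 0 ≤ Φ X
  G_nonneg : ∀ P, 0 ≤ P → 0 ≤ G P
  sQ_pos : 0 < sQ
  sR_pos : 0 < sR
  mu_pos : 0 < mu
  b_pos : 0 < b
  r_nonneg : 0 ≤ r
  sQ_le : sQ • 1 ≤ Q
  sR_le : sR • 1 ≤ R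
  R_le : R ≤ r • 1
  mu_le : mu • 1 ≤ X₀
  Φ_input_le : Φ (Matrix.fromBlocks 0 0 0 1) ≤ b • 1
  G_input_le : (G 1).toBlocks₂₂ ≤ b • 1

namespace MomentModel

variable {n m : Type*} [Fintype n] [Fintype m] [DecidableEq n] [DecidableEq m]
  (D : MomentModel n m) {L Δ : Matrix m n ℝ}

/-- The feedback `u = -L x`, as the map `x ↦ (x, u)`. -/
def graph (L : Matrix m n ℝ) : Matrix (n ⊕ m) n ℝ := Matrix.fromRows 1 (-L)

/-- The inclusion `u ↦ (0, u)` of controls into state-control pairs. -/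
def inputIncl : Matrix (n ⊕ m) m ℝ := Matrix.fromRows 0 1

theorem graph_add (L Δ : Matrix m n ℝ) :
    graph (L + Δ) = graph L - (inputIncl : Matrix (n ⊕ m) m ℝ) * Δ := by
  ext (i | i) j <;> simp [graph, inputIncl, Matrix.fromRows_mul]; ring

theorem inputIncl_mul_transpose :
    (inputIncl : Matrix (n ⊕ m) m ℝ) * (inputIncl : Matrix (n ⊕ m) m ℝ)ᵀ =
      Matrix.fromBlocks 0 0 0 1 := by
  ext (i | i) (j | j) <;> simp [inputIncl, Matrix.transpose_fromRows,
    Matrix.mul_fromCols]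

theorem inputIncl_conj (M : Matrix (n ⊕ m) (n ⊕ m) ℝ) :
    (inputIncl : Matrix (n ⊕ m) m ℝ)ᵀ * M * (inputIncl : Matrix (n ⊕ m) m ℝ) =
      M.toBlocks₂₂ := by
  conv_lhs => rw [← Matrix.fromBlocks_toBlocks M]
  simp [inputIncl, Matrix.transpose_fromRows, Matrix.fromCols_mul_fromBlocks,
    Matrix.fromCols_mul_fromRows]

/-- The block diagonal cost matrix. -/
def N : Matrix (n ⊕ m) (n ⊕ m) ℝ := Matrix.fromBlocks D.Q 0 0 D.R

/-- The mean cost matrix of the feedback `u = -L x`. -/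
def costMat (L : Matrix m n ℝ) : Matrix n n ℝ := (graph L)ᵀ * D.N * graph L

/-- One step of the second moment matrix under the feedback `u = -L x`. -/
def F (L : Matrix m n ℝ) : Matrix n n ℝ →ₗ[ℝ] Matrix n n ℝ where
  toFun X := D.Φ (graph L * X * (graph L)ᵀ)
  map_add' X Y := by simp [Matrix.mul_add, Matrix.add_mul]
  map_smul' c X := by simp

/-- The trace adjoint of `F`. -/
def Fadj (L : Matrix m n ℝ) : Matrix n n ℝ →ₗ[ℝ] Matrix n n ℝ where
  toFun P := (graph L)ᵀ * D.G P * graph L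
  map_add' X Y := by simp [Matrix.mul_add, Matrix.add_mul]
  map_smul' c X := by simp

theorem F_apply (X : Matrix n n ℝ) : D.F L X = D.Φ (graph L * X * (graph L)ᵀ) := rfl

theorem Fadj_apply (P : Matrix n n ℝ) : D.Fadj L P = (graph L)ᵀ * D.G P * graph L := rfl

theorem trace_Fadj_mul (P X : Matrix n n ℝ) : (D.Fadj L P * X).trace = (P * D.F L X).trace := by
  rw [F_apply, ← D.trace_G_mul, Fadj_apply, Matrix.mul_assoc, Matrix.mul_assoc,
    Matrix.trace_mul_comm]
  simp only [Matrix.mul_assoc]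

theorem trace_Fadj_pow_mul (t : ℕ) (P X : Matrix n n ℝ) :
    ((D.Fadj L ^ t) P * X).trace = (P * (D.F L ^ t) X).trace := by
  induction t generalizing P X with
  | zero => simp
  | succ t ih =>
    rw [pow_succ', pow_succ, Module.End.mul_apply, Module.End.mul_apply, trace_Fadj_mul, ih]

theorem F_nonneg {X : Matrix n n ℝ} (hX : 0 ≤ X) : 0 ≤ D.F L X :=
  D.Φ_nonneg _ (conj_nonneg hX _)

theorem Φ_mono {X Y : Matrix (n ⊕ m) (n ⊕ m) ℝ} (h : X ≤ Y) : D.Φ X ≤ D.Φ Y := by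
  have := D.Φ_nonneg _ (sub_nonneg.2 h)
  rw [map_sub] at this
  exact sub_nonneg.1 this

theorem G_mono {X Y : Matrix n n ℝ} (h : X ≤ Y) : D.G X ≤ D.G Y := by
  have := D.G_nonneg _ (sub_nonneg.2 h)
  rw [map_sub] at this
  exact sub_nonneg.1 this

theorem F_mono {X Y : Matrix n n ℝ} (h : X ≤ Y) : D.F L X ≤ D.F L Y :=
  D.Φ_mono (conj_mono h _)

theorem F_pow_nonneg (t : ℕ) {X : Matrix n n ℝ} (hX : 0 ≤ X) : 0 ≤ (D.F L ^ t) X := by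
  induction t with
  | zero => simpa using hX
  | succ t ih =>
    rw [pow_succ', Module.End.mul_apply]
    exact D.F_nonneg ih

theorem F_pow_mono (t : ℕ) {X Y : Matrix n n ℝ} (h : X ≤ Y) :
    (D.F L ^ t) X ≤ (D.F L ^ t) Y := by
  have := D.F_pow_nonneg (L := L) t (sub_nonneg.2 h)
  rw [map_sub] at this
  exact sub_nonneg.1 this

theorem Fadj_nonneg {P : Matrix n n ℝ} (hP : 0 ≤ P) : 0 ≤ D.Fadj L P := by
  simpa [Fadj_apply] using conj_nonneg (D.G_nonneg P hP) (graph L)ᵀ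

theorem Fadj_pow_nonneg (t : ℕ) {X : Matrix n n ℝ} (hX : 0 ≤ X) : 0 ≤ (D.Fadj L ^ t) X := by
  induction t with
  | zero => simpa using hX
  | succ t ih =>
    rw [pow_succ', Module.End.mul_apply]
    exact D.Fadj_nonneg ih

theorem Q_nonneg : 0 ≤ D.Q :=
  (smul_nonneg_matrix D.sQ_pos.le one_nonneg_matrix).trans D.sQ_le

theorem R_nonneg : 0 ≤ D.R :=
  (smul_nonneg_matrix D.sR_pos.le one_nonneg_matrix).trans D.sR_le

theorem X₀_nonneg : 0 ≤ D.X₀ :=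
  (smul_nonneg_matrix D.mu_pos.le one_nonneg_matrix).trans D.mu_le

theorem costMat_eq (L : Matrix m n ℝ) : D.costMat L = D.Q + Lᵀ * D.R * L := by
  simp [costMat, N, graph, Matrix.transpose_fromRows, Matrix.fromCols_mul_fromBlocks,
    Matrix.fromCols_mul_fromRows]

theorem Q_le_costMat : D.Q ≤ D.costMat L := by
  rw [costMat_eq]
  exact le_add_of_nonneg_right (by simpa using conj_nonneg D.R_nonneg Lᵀ)

theorem costMat_nonneg : 0 ≤ D.costMat L := D.Q_nonneg.trans D.Q_le_costMat

/-- Mean-square stability of the feedback `u = -L x`, in summed form. -/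
def Stable (L : Matrix m n ℝ) : Prop := Summable fun t : ℕ => ((D.F L ^ t) 1).trace

variable {D}

theorem Stable.summable_trace (h : D.Stable L) {X : Matrix n n ℝ} (hX : 0 ≤ X) :
    Summable fun t : ℕ => ((D.F L ^ t) X).trace := by
  refine Summable.of_nonneg_of_le (fun t => trace_nonneg_of_nonneg (D.F_pow_nonneg t hX))
    (fun t => ?_) (h.mul_left X.trace)
  have := trace_mono (D.F_pow_mono (L := L) t (le_trace_smul_one hX))
  simpa using this

theorem Stable.summable (h : D.Stable L) {X : Matrix n n ℝ} (hX : 0 ≤ X) :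
    Summable fun t : ℕ => (D.F L ^ t) X :=
  summable_matrix_of_trace (fun t => D.F_pow_nonneg t hX) (h.summable_trace hX)

theorem tendsto_F_pow_zero (h : Tendsto (fun t : ℕ => ((D.F L ^ t) 1).trace) atTop (𝓝 0))
    {U : Matrix n n ℝ} (hU : U.IsSymm) : Tendsto (fun t : ℕ => (D.F L ^ t) U) atTop (𝓝 0) := by
  have hpos : ∀ X : Matrix n n ℝ, 0 ≤ X → Tendsto (fun t : ℕ => (D.F L ^ t) X) atTop (𝓝 0) := by
    intro X hX
    refine tendsto_pi_nhds.2 fun i => tendsto_pi_nhds.2 fun j => ?_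
    refine squeeze_zero_norm (fun t => ?_) (by simpa using h.const_mul X.trace)
    refine (abs_apply_le_trace (D.F_pow_nonneg t hX) i j).trans ?_
    simpa using trace_mono (D.F_pow_mono (L := L) t (le_trace_smul_one hX))
  obtain ⟨c, hc⟩ := exists_add_smul_one_nonneg hU
  simpa using (hpos _ hc).sub ((hpos _ one_nonneg_matrix).const_smul c)

theorem Stable.tendsto_zero (h : D.Stable L) {U : Matrix n n ℝ} (hU : U.IsSymm) :
    Tendsto (fun t : ℕ => (D.F L ^ t) U) atTop (𝓝 0) :=
  tendsto_F_pow_zero h.tendsto_atTop_zero hU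

/-- Comparison principle: under a stable feedback, `F U ≤ U` forces `U` to be nonnegative, since
`F ^ t U` decreases to zero. -/
theorem Stable.nonneg_of_F_le (h : D.Stable L) {U : Matrix n n ℝ} (hU : U.IsSymm)
    (hF : D.F L U ≤ U) : 0 ≤ U := by
  have hle : ∀ t : ℕ, (D.F L ^ t) U ≤ U := by
    intro t
    induction t with
    | zero => simp
    | succ t ih =>
      rw [pow_succ', Module.End.mul_apply]
      exact (D.F_mono ih).trans hF
  refine nonneg_of_tendsto (A := fun t => U - (D.F L ^ t) U) (fun t => sub_nonneg.2 (hle t)) ?_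
  simpa using (h.tendsto_zero hU).const_sub U

/-- Lyapunov's criterion for mean-square stability: the partial sums of `ν F ^ t 1` are bounded
by `X`. -/
theorem stable_of_lyapunov {X : Matrix n n ℝ} (hX : 0 ≤ X) {ν : ℝ} (hν : 0 < ν)
    (h : D.F L X + ν • 1 ≤ X) : D.Stable L := by
  have hsum : ∀ T : ℕ, ν • ∑ t ∈ Finset.range T, (D.F L ^ t) 1 + (D.F L ^ T) X ≤ X := by
    intro T
    induction T with
    | zero => simp
    | succ T ih =>
      refine le_trans ?_ ih
      have := D.F_pow_mono (L := L) T h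
      rw [map_add, map_smul] at this
      rw [Finset.sum_range_succ, smul_add, pow_succ, Module.End.mul_apply, add_assoc]
      exact add_le_add_right (by rwa [add_comm]) _
  refine summable_of_sum_range_le (c := X.trace / ν)
    (fun t => trace_nonneg_of_nonneg (D.F_pow_nonneg t one_nonneg_matrix)) fun T => ?_
  rw [le_div_iff₀ hν]
  have h1 := trace_mono (hsum T)
  have h2 := trace_nonneg_of_nonneg (D.F_pow_nonneg (L := L) T hX)
  rw [Matrix.trace_add, Matrix.trace_smul, Matrix.trace_sum, smul_eq_mul] at h1
  linarith

variable (D)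

/-- The aggregate second moment matrix `Σ_L`. -/
noncomputable def sigma (L : Matrix m n ℝ) : Matrix n n ℝ := ∑' t : ℕ, (D.F L ^ t) D.X₀

/-- The matrix of the quadratic cost-to-go function of the feedback `u = -L x`. -/
noncomputable def value (L : Matrix m n ℝ) : Matrix n n ℝ :=
  ∑' t : ℕ, (D.Fadj L ^ t) (D.costMat L)

/-- The cost of the feedback `u = -L x`. -/
noncomputable def cost (L : Matrix m n ℝ) : ℝ := (D.sigma L * D.costMat L).trace

variable {D}

theorem Stable.sigma_fixed (h : D.Stable L) : D.sigma L = D.X₀ + D.F L (D.sigma L) :=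
  tsum_pow_apply_eq _ _ (h.summable D.X₀_nonneg)

theorem Stable.sigma_nonneg (h : D.Stable L) : 0 ≤ D.sigma L :=
  tsum_nonneg_matrix (fun t => D.F_pow_nonneg t D.X₀_nonneg) (h.summable D.X₀_nonneg)

theorem Stable.X₀_le_sigma (h : D.Stable L) : D.X₀ ≤ D.sigma L := by
  rw [h.sigma_fixed]
  exact le_add_of_nonneg_right (D.F_nonneg h.sigma_nonneg)

theorem Stable.mu_le_sigma (h : D.Stable L) : D.mu • 1 ≤ D.sigma L :=
  D.mu_le.trans h.X₀_le_sigma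

theorem Stable.summable_value (h : D.Stable L) :
    Summable fun t : ℕ => (D.Fadj L ^ t) (D.costMat L) := by
  refine summable_matrix_of_trace (fun t => D.Fadj_pow_nonneg t D.costMat_nonneg) ?_
  refine Summable.of_nonneg_of_le
    (fun t => trace_nonneg_of_nonneg (D.Fadj_pow_nonneg t D.costMat_nonneg))
    (fun t => ?_) (h.mul_left (D.costMat L).trace)
  have h1 := D.trace_Fadj_pow_mul (L := L) t (D.costMat L) 1
  rw [Matrix.mul_one] at h1
  rw [h1]
  have := trace_mul_mono_left (le_trace_smul_one (D.costMat_nonneg (L := L)))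
    (D.F_pow_nonneg (L := L) t one_nonneg_matrix)
  simpa using this

theorem Stable.value_fixed (h : D.Stable L) :
    D.value L = D.costMat L + D.Fadj L (D.value L) :=
  tsum_pow_apply_eq _ _ h.summable_value

theorem Stable.value_nonneg (h : D.Stable L) : 0 ≤ D.value L :=
  tsum_nonneg_matrix (fun t => D.Fadj_pow_nonneg t D.costMat_nonneg) h.summable_value

/-- The cost expressed through the value matrix, by duality of the two fixed point equations. -/
theorem Stable.cost_eq (h : D.Stable L) : D.cost L = (D.value L * D.X₀).trace := by
  have h1 : D.X₀ = D.sigma L - D.F L (D.sigma L) := eq_sub_of_add_eq h.sigma_fixed.symm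
  have h2 : D.costMat L = D.value L - D.Fadj L (D.value L) :=
    eq_sub_of_add_eq h.value_fixed.symm
  rw [h1, Matrix.mul_sub, Matrix.trace_sub, ← trace_Fadj_mul, cost, h2, Matrix.mul_sub,
    Matrix.trace_sub, Matrix.trace_mul_comm, Matrix.trace_mul_comm (D.sigma L)]

theorem Stable.cost_nonneg (h : D.Stable L) : 0 ≤ D.cost L :=
  trace_mul_nonneg h.sigma_nonneg D.costMat_nonneg

theorem Stable.mu_mul_trace_value_le (h : D.Stable L) :
    D.mu * (D.value L).trace ≤ D.cost L := by
  rw [h.cost_eq]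
  simpa using trace_mul_mono_right h.value_nonneg D.mu_le

theorem Stable.sQ_mul_trace_sigma_le (h : D.Stable L) :
    D.sQ * (D.sigma L).trace ≤ D.cost L := by
  simpa [cost] using trace_mul_mono_right h.sigma_nonneg (D.sQ_le.trans (D.Q_le_costMat (L := L)))

/-- The cost is coercive in the feedback matrix. -/
theorem Stable.coercive (h : D.Stable L) :
    D.mu * D.sR * (Lᵀ * L).trace ≤ D.cost L := by
  have h1 := trace_mul_mono_left h.mu_le_sigma (D.costMat_nonneg (L := L))
  have h2 : D.sR • (Lᵀ * L) ≤ D.costMat L := by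
    rw [costMat_eq]
    have := conj_transpose_mono D.sR_le L
    simp only [Matrix.mul_smul, Matrix.mul_one, Matrix.smul_mul] at this
    exact this.trans (le_add_of_nonneg_left D.Q_nonneg)
  have h3 := trace_mono h2
  simp only [Matrix.smul_mul, Matrix.one_mul, Matrix.trace_smul, smul_eq_mul] at h1 h3
  rw [mul_assoc]
  exact (mul_le_mul_of_nonneg_left h3 D.mu_pos.le).trans h1

end MomentModel
end

/-! ### Cost differences, the residual and perturbation of the feedback -/

section
open scoped MatrixOrder

namespace MomentModel

variable {n m : Type*} [Fintype n] [Fintype m] [DecidableEq n] [DecidableEq m]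
  {D : MomentModel n m} {L Δ : Matrix m n ℝ}

variable (D)

/-- The matrix of the quadratic function `(x, u) ↦ E[(x, u)ᵀ N (x, u) + x₊ᵀ P x₊]`, where `x₊` is the
next state. -/
def qMat (P : Matrix n n ℝ) : Matrix (n ⊕ m) (n ⊕ m) ℝ := D.N + D.G P

/-- The control block `E[R + Bᵀ P B]` of `qMat`. -/
def inputMat (P : Matrix n n ℝ) : Matrix m m ℝ :=
  (inputIncl : Matrix (n ⊕ m) m ℝ)ᵀ * D.qMat P * (inputIncl : Matrix (n ⊕ m) m ℝ)

/-- The residual `E[(R + Bᵀ P B) L - Bᵀ P A]`, where `P` is the value matrix of `L`; it vanishes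
exactly at the critical points of the cost. -/
noncomputable def residual (L : Matrix m n ℝ) : Matrix m n ℝ :=
  -((inputIncl : Matrix (n ⊕ m) m ℝ)ᵀ * D.qMat (D.value L) * graph L)

variable {D}

theorem N_nonneg : 0 ≤ D.N := by
  have h1 := conj_nonneg D.Q_nonneg (Matrix.fromRows (1 : Matrix n n ℝ) (0 : Matrix m n ℝ))
  have h2 := conj_nonneg D.R_nonneg (inputIncl : Matrix (n ⊕ m) m ℝ)
  convert add_nonneg h1 h2 using 1
  ext (i | i) (j | j) <;> simp [N, inputIncl, Matrix.transpose_fromRows,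
    Matrix.mul_fromCols, Matrix.fromRows_mul]

theorem qMat_nonneg {P : Matrix n n ℝ} (hP : 0 ≤ P) : 0 ≤ D.qMat P :=
  add_nonneg N_nonneg (D.G_nonneg P hP)

theorem inputMat_eq (P : Matrix n n ℝ) : D.inputMat P = D.R + (D.G P).toBlocks₂₂ := by
  rw [inputMat, inputIncl_conj, qMat]
  ext i j
  simp [N, Matrix.toBlocks₂₂]

theorem toBlocks₂₂_mono {X Y : Matrix (n ⊕ m) (n ⊕ m) ℝ} (h : X ≤ Y) :
    X.toBlocks₂₂ ≤ Y.toBlocks₂₂ := by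
  rw [← inputIncl_conj, ← inputIncl_conj]
  exact conj_transpose_mono h _

theorem sR_le_inputMat {P : Matrix n n ℝ} (hP : 0 ≤ P) : D.sR • 1 ≤ D.inputMat P := by
  rw [inputMat_eq]
  refine D.sR_le.trans (le_add_of_nonneg_right ?_)
  have := toBlocks₂₂_mono (D.G_nonneg P hP)
  convert this using 1
  ext i j
  rfl

theorem inputMat_le {P : Matrix n n ℝ} {p : ℝ} (hP : P ≤ p • 1) (hp : 0 ≤ p) :
    D.inputMat P ≤ (D.r + D.b * p) • 1 := by
  rw [inputMat_eq, add_smul]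
  refine add_le_add D.R_le ?_
  have h1 := toBlocks₂₂_mono (D.G_mono hP)
  refine h1.trans ?_
  rw [map_smul, mul_comm, mul_smul]
  exact smul_mono_matrix hp D.G_input_le

theorem qMat_transpose {P : Matrix n n ℝ} (hP : 0 ≤ P) : (D.qMat P)ᵀ = D.qMat P :=
  isSymm_of_nonneg (qMat_nonneg hP)

theorem graph_conj_qMat (L : Matrix m n ℝ) (P : Matrix n n ℝ) :
    (graph L)ᵀ * D.qMat P * graph L = D.costMat L + D.Fadj L P := by
  rw [qMat, Matrix.mul_add, Matrix.add_mul]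
  rfl

theorem Stable.graph_conj_qMat (h : D.Stable L) :
    (graph L)ᵀ * D.qMat (D.value L) * graph L = D.value L := by
  rw [MomentModel.graph_conj_qMat]
  exact h.value_fixed.symm

theorem Stable.residual_transpose (h : D.Stable L) :
    (D.residual L)ᵀ = -((graph L)ᵀ * D.qMat (D.value L) * (inputIncl : Matrix (n ⊕ m) m ℝ)) := by
  rw [residual, Matrix.transpose_neg, Matrix.transpose_mul, Matrix.transpose_mul,
    qMat_transpose h.value_nonneg, Matrix.transpose_transpose, Matrix.mul_assoc]

/-- The advantage of switching for one step from the feedback `L` to `L + Δ`. -/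
theorem Stable.advantage (h : D.Stable L) (Δ : Matrix m n ℝ) :
    D.costMat (L + Δ) + D.Fadj (L + Δ) (D.value L) - D.value L =
      Δᵀ * D.residual L + (D.residual L)ᵀ * Δ + Δᵀ * D.inputMat (D.value L) * Δ := by
  rw [← MomentModel.graph_conj_qMat, h.residual_transpose, residual, inputMat, graph_add]
  conv_lhs => rw [← h.graph_conj_qMat]
  simp only [Matrix.transpose_sub, Matrix.transpose_mul, Matrix.sub_mul, Matrix.mul_sub,
    Matrix.mul_neg, Matrix.neg_mul, Matrix.mul_assoc, h.graph_conj_qMat]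
  abel

theorem trace_mul_transpose_mul (S : Matrix n n ℝ) (A B : Matrix m n ℝ) :
    (S * (Aᵀ * B)).trace = (B * S * Aᵀ).trace := by
  rw [← Matrix.mul_assoc, Matrix.trace_mul_comm, Matrix.mul_assoc]

theorem trace_mul_transpose_mul' {S : Matrix n n ℝ} (hS : Sᵀ = S) (A B : Matrix m n ℝ) :
    (S * (Bᵀ * A)).trace = (B * S * Aᵀ).trace := by
  rw [← Matrix.trace_transpose]
  simp only [Matrix.transpose_mul, Matrix.transpose_transpose, hS]
  rw [Matrix.trace_mul_comm, ← Matrix.mul_assoc, Matrix.trace_mul_comm, ← Matrix.mul_assoc]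

/-- The cost difference formula. -/
theorem Stable.cost_sub (h : D.Stable L) (h' : D.Stable (L + Δ)) :
    D.cost (L + Δ) - D.cost L = 2 * (D.residual L * D.sigma (L + Δ) * Δᵀ).trace +
      (D.sigma (L + Δ) * (Δᵀ * D.inputMat (D.value L) * Δ)).trace := by
  have hs : (D.sigma (L + Δ))ᵀ = D.sigma (L + Δ) := isSymm_of_nonneg h'.sigma_nonneg
  have h3 : (D.sigma (L + Δ) * (D.costMat (L + Δ) + D.Fadj (L + Δ) (D.value L) -
      D.value L)).trace = D.cost (L + Δ) - D.cost L := by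
    rw [Matrix.mul_sub, Matrix.mul_add, Matrix.trace_sub, Matrix.trace_add,
      Matrix.trace_mul_comm _ (D.Fadj _ _), trace_Fadj_mul, h.cost_eq, cost]
    have : D.F (L + Δ) (D.sigma (L + Δ)) = D.sigma (L + Δ) - D.X₀ :=
      eq_sub_of_add_eq' h'.sigma_fixed.symm
    rw [this, Matrix.mul_sub, Matrix.trace_sub, Matrix.trace_mul_comm (D.sigma _) (D.value _)]
    ring
  rw [← h3, h.advantage, Matrix.mul_add, Matrix.mul_add, Matrix.trace_add, Matrix.trace_add,
    trace_mul_transpose_mul, trace_mul_transpose_mul' hs]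
  ring

/-- The residual is controlled by the value matrix: the form `qMat` is nonnegative on the pairs
`(x, -L x + ρ⁻¹ E x)`, where `E` is the residual. This bound does not involve the size of `L`. -/
theorem Stable.residual_gram_le (h : D.Stable L) {ρ : ℝ} (hρ : 0 < ρ)
    (hR : D.inputMat (D.value L) ≤ ρ • 1) :
    (D.residual L)ᵀ * D.residual L ≤ ρ • D.value L := by
  have hpos := conj_transpose_mono (qMat_nonneg (D := D) h.value_nonneg)
    (graph L + ρ⁻¹ • ((inputIncl : Matrix (n ⊕ m) m ℝ) * D.residual L))
  have h1 := conj_transpose_mono hR (D.residual L)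
  have h2 : (graph L + ρ⁻¹ • ((inputIncl : Matrix (n ⊕ m) m ℝ) * D.residual L))ᵀ *
      D.qMat (D.value L) *
        (graph L + ρ⁻¹ • ((inputIncl : Matrix (n ⊕ m) m ℝ) * D.residual L)) =
      D.value L - (2 * ρ⁻¹) • ((D.residual L)ᵀ * D.residual L) +
        ρ⁻¹ ^ 2 • ((D.residual L)ᵀ * D.inputMat (D.value L) * D.residual L) := by
    have e1 : (graph L)ᵀ * (D.qMat (D.value L) * ((inputIncl : Matrix (n ⊕ m) m ℝ) *
        D.residual L)) = -((D.residual L)ᵀ * D.residual L) := by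
      rw [h.residual_transpose]
      simp only [Matrix.mul_assoc, Matrix.neg_mul, neg_neg]
    have e2 : (D.residual L)ᵀ * ((inputIncl : Matrix (n ⊕ m) m ℝ)ᵀ * (D.qMat (D.value L) *
        graph L)) = -((D.residual L)ᵀ * D.residual L) := by
      conv_rhs => rw [residual]
      simp only [Matrix.mul_assoc, Matrix.mul_neg, neg_neg, residual]
    have e3 := h.graph_conj_qMat
    rw [Matrix.mul_assoc] at e3
    simp only [Matrix.transpose_add, Matrix.transpose_smul, Matrix.transpose_mul, Matrix.add_mul,
      Matrix.mul_add, Matrix.smul_mul, Matrix.mul_smul, inputMat, Matrix.mul_assoc, e1, e2, e3]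
    module
  rw [h2] at hpos
  simp only [Matrix.mul_zero, Matrix.zero_mul] at hpos
  simp only [Matrix.mul_smul, Matrix.mul_one, Matrix.smul_mul] at h1
  have h3 := smul_mono_matrix (sq_nonneg ρ⁻¹) h1
  have h4 := hpos.trans (add_le_add_right h3 _)
  have h5 := smul_nonneg_matrix hρ.le h4
  rw [← sub_nonneg]
  convert h5 using 1
  match_scalars <;> field_simp; norm_num

theorem Stable.value_le (h : D.Stable L) {p : ℝ} (hp : (D.value L).trace ≤ p) :
    D.value L ≤ p • 1 :=
  (le_trace_smul_one h.value_nonneg).trans (smul_mono_scalar one_nonneg_matrix hp)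

theorem Stable.sigma_le (h : D.Stable L) {s : ℝ} (hs : (D.sigma L).trace ≤ s) :
    D.sigma L ≤ s • 1 :=
  (le_trace_smul_one h.sigma_nonneg).trans (smul_mono_scalar one_nonneg_matrix hs)

/-- Lower bound for the cost of a competitor, by completing the square. -/
theorem Stable.cost_sub_le (h : D.Stable L) (h' : D.Stable (L + Δ)) :
    D.cost L - D.cost (L + Δ) ≤
      (D.sigma (L + Δ) * ((D.residual L)ᵀ * D.residual L)).trace / D.sR := by
  have hs : (D.sigma (L + Δ))ᵀ = D.sigma (L + Δ) := isSymm_of_nonneg h'.sigma_nonneg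
  have h1 := conj_transpose_mono (sR_le_inputMat (D := D) h.value_nonneg) Δ
  have h2 := trace_mul_mono_right h'.sigma_nonneg h1
  have h3 := trace_mul_nonneg h'.sigma_nonneg (transpose_mul_nonneg (D.sR • Δ + D.residual L))
  simp only [Matrix.transpose_add, Matrix.transpose_smul, Matrix.add_mul,
    Matrix.mul_add, Matrix.smul_mul, Matrix.mul_smul, Matrix.trace_add, Matrix.trace_smul,
    smul_eq_mul, trace_mul_transpose_mul, Matrix.mul_one] at h2 h3
  rw [← trace_mul_transpose_mul _ (D.residual L) Δ, trace_mul_transpose_mul' hs] at h3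
  rw [le_div_iff₀ D.sR_pos, ← neg_sub, h.cost_sub h', trace_mul_transpose_mul]
  have := mul_le_mul_of_nonneg_left h2 D.sR_pos.le
  linarith

theorem inputIncl_conj_le {X : Matrix n n ℝ} {x : ℝ} (hx : 0 ≤ x) (hX : X ≤ x • 1)
    (Δ : Matrix m n ℝ) :
    D.Φ ((inputIncl : Matrix (n ⊕ m) m ℝ) * Δ * X * ((inputIncl : Matrix (n ⊕ m) m ℝ) * Δ)ᵀ) ≤
      (x * (D.b * (Δᵀ * Δ).trace)) • 1 := by
  have h1 := D.Φ_mono (conj_mono hX ((inputIncl : Matrix (n ⊕ m) m ℝ) * Δ))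
  refine h1.trans ?_
  have h2 := conj_mono (mul_transpose_self_le Δ) (inputIncl : Matrix (n ⊕ m) m ℝ)
  simp only [Matrix.mul_smul, Matrix.mul_one, Matrix.smul_mul, inputIncl_mul_transpose] at h2 ⊢
  have h3 := D.Φ_mono h2
  have ht : 0 ≤ (Δᵀ * Δ).trace := trace_nonneg_of_nonneg (transpose_mul_nonneg Δ)
  rw [map_smul] at h3 ⊢
  have h4 := h3.trans (smul_mono_matrix ht D.Φ_input_le)
  rw [mul_smul]
  refine smul_mono_matrix hx ?_
  rw [mul_comm D.b, mul_smul]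
  simpa only [Matrix.transpose_mul, Matrix.mul_assoc] using h4

/-- Young's inequality for the one step map of a perturbed feedback. Since `F L X ≤ X`, no bound on
the closed loop matrix is needed. -/
theorem F_add_bounds {X : Matrix n n ℝ} (hX : 0 ≤ X) {x τ : ℝ} (hx : X ≤ x • 1)
    (hx0 : 0 ≤ x) (hF : D.F L X ≤ X) (hτ : 0 < τ) (hτ1 : τ ≤ 1)
    (hΔ : D.b * (Δᵀ * Δ).trace ≤ τ ^ 2) :
    D.F (L + Δ) X ≤ D.F L X + (3 * x * τ) • 1 ∧ D.F L X ≤ D.F (L + Δ) X + (3 * x * τ) • 1 := by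
  set J : Matrix (n ⊕ m) n ℝ := (inputIncl : Matrix (n ⊕ m) m ℝ) * Δ with hJ
  have hJX : D.Φ (J * X * Jᵀ) ≤ (x * τ ^ 2) • 1 :=
    (inputIncl_conj_le hx0 hx Δ).trans
      (smul_mono_scalar one_nonneg_matrix (mul_le_mul_of_nonneg_left hΔ hx0))
  have hFx : D.F L X ≤ x • 1 := hF.trans hx
  have hF' : D.F (L + Δ) X = D.F L X - D.Φ (graph L * X * Jᵀ + J * X * (graph L)ᵀ) +
      D.Φ (J * X * Jᵀ) := by
    rw [F_apply, F_apply, graph_add, ← hJ, ← map_sub, ← map_add]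
    congr 1
    simp only [Matrix.transpose_sub, Matrix.sub_mul, Matrix.mul_sub]
    abel
  -- The sign `σ` gives the upper and the lower bound for the cross terms at once.
  have hpos : ∀ σ : ℝ, σ ^ 2 = 1 → 0 ≤ τ • D.F L X +
      σ • D.Φ (graph L * X * Jᵀ + J * X * (graph L)ᵀ) + τ⁻¹ • D.Φ (J * X * Jᵀ) := by
    intro σ hσ
    have h := smul_nonneg_matrix (inv_nonneg.2 hτ.le)
      (D.Φ_nonneg _ (conj_nonneg hX ((σ * τ) • graph L + J)))
    convert h using 1
    rw [F_apply, ← map_smul, ← map_smul, ← map_smul, ← map_smul, ← map_add, ← map_add]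
    congr 1
    simp only [Matrix.transpose_add, Matrix.transpose_smul, Matrix.add_mul, Matrix.mul_add,
      Matrix.smul_mul, Matrix.mul_smul]
    match_scalars <;> field_simp
    exact hσ.symm
  have hinv : τ⁻¹ * (x * τ ^ 2) = x * τ := by field_simp
  have a1 : τ • D.F L X ≤ (τ * x) • 1 := by
    rw [mul_smul]; exact smul_mono_matrix hτ.le hFx
  have a2 : τ⁻¹ • D.Φ (J * X * Jᵀ) ≤ (x * τ) • 1 := by
    rw [← hinv, mul_smul]; exact smul_mono_matrix (inv_nonneg.2 hτ.le) hJX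
  have a3 : D.Φ (J * X * Jᵀ) ≤ (x * τ) • 1 :=
    hJX.trans (smul_mono_scalar one_nonneg_matrix (mul_le_mul_of_nonneg_left (by nlinarith) hx0))
  have a4 : 0 ≤ D.Φ (J * X * Jᵀ) := D.Φ_nonneg _ (conj_nonneg hX J)
  have a5 : (0 : Matrix n n ℝ) ≤ (x * τ) • 1 :=
    smul_nonneg_matrix (by positivity) one_nonneg_matrix
  have p1 := hpos 1 (by norm_num)
  have p2 := hpos (-1) (by norm_num)
  rw [hF']
  constructor
  · rw [← sub_nonneg] at a1 a2 a3 ⊢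
    convert add_nonneg (add_nonneg p1 a1) (add_nonneg a2 a3) using 1
    module
  · rw [← sub_nonneg] at a1 a2 ⊢
    convert add_nonneg (add_nonneg p2 a1) (add_nonneg (add_nonneg a2 a4) a5) using 1
    module

/-- Quantitative robustness of stability, and continuity of the aggregate second moments.
The matrix `Σ_L` satisfies Lyapunov's criterion for `L + Δ`, and comparison with `Σ_{L + Δ}` gives
`(1 - κ) Σ_{L + Δ} ≤ Σ_L ≤ (1 + κ) Σ_{L + Δ}`. -/
theorem Stable.perturb (h : D.Stable L) {s τ κ : ℝ} (hs : (D.sigma L).trace ≤ s)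
    (hτ : 0 < τ) (hτ1 : τ ≤ 1) (hΔ : D.b * (Δᵀ * Δ).trace ≤ τ ^ 2)
    (hκ : 3 * s * τ ≤ κ * D.mu) (hκ1 : κ ≤ 1 / 2) :
    D.Stable (L + Δ) ∧ D.sigma (L + Δ) ≤ (2 : ℝ) • D.sigma L ∧
      D.sigma (L + Δ) - D.sigma L ≤ (2 * κ * s) • 1 ∧
      -((2 * κ * s) • 1) ≤ D.sigma (L + Δ) - D.sigma L := by
  have hs0 : 0 ≤ s := (trace_nonneg_of_nonneg h.sigma_nonneg).trans hs
  have hκ0 : 0 ≤ κ := by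
    have : 0 ≤ κ * D.mu := le_trans (by positivity) hκ
    exact nonneg_of_mul_nonneg_left this D.mu_pos
  have hX := h.sigma_nonneg
  have hfix := h.sigma_fixed
  have hFX : D.F L (D.sigma L) ≤ D.sigma L := by
    conv_rhs => rw [hfix]
    exact le_add_of_nonneg_left D.X₀_nonneg
  obtain ⟨b1, b2⟩ := F_add_bounds hX (h.sigma_le hs) hs0 hFX hτ hτ1 hΔ
  have hκX : (3 * s * τ) • (1 : Matrix n n ℝ) ≤ κ • D.X₀ := by
    refine (smul_mono_scalar one_nonneg_matrix hκ).trans ?_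
    rw [mul_smul]
    exact smul_mono_matrix hκ0 D.mu_le
  have hup : D.F (L + Δ) (D.sigma L) + (1 - κ) • D.X₀ ≤ D.sigma L := by
    rw [← sub_nonneg] at b1 hκX ⊢
    convert add_nonneg b1 hκX using 1
    conv_lhs => enter [1]; rw [hfix]
    module
  have hlo : D.sigma L ≤ D.F (L + Δ) (D.sigma L) + (1 + κ) • D.X₀ := by
    rw [← sub_nonneg] at b2 hκX ⊢
    convert add_nonneg b2 hκX using 1
    conv_lhs => enter [2]; rw [hfix]
    module
  have hst : D.Stable (L + Δ) := by
    refine stable_of_lyapunov hX (ν := (1 - κ) * D.mu) (mul_pos (by linarith) D.mu_pos) ?_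
    refine le_trans (add_le_add_right ?_ _) hup
    rw [mul_smul]
    exact smul_mono_matrix (by linarith) D.mu_le
  have hfix' := hst.sigma_fixed
  have hsy : (D.sigma L).IsSymm := isSymm_of_nonneg hX
  have hsy' : (D.sigma (L + Δ)).IsSymm := isSymm_of_nonneg hst.sigma_nonneg
  have c1 : 0 ≤ D.sigma L - (1 - κ) • D.sigma (L + Δ) := by
    refine hst.nonneg_of_F_le (hsy.sub (hsy'.smul _)) ?_
    rw [map_sub, map_smul]
    rw [← sub_nonneg] at hup ⊢
    convert hup using 1
    conv_lhs => enter [1, 2, 2]; rw [hfix']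
    module
  have c2 : 0 ≤ (1 + κ) • D.sigma (L + Δ) - D.sigma L := by
    refine hst.nonneg_of_F_le ((hsy'.smul _).sub hsy) ?_
    rw [map_sub, map_smul]
    rw [← sub_nonneg] at hlo ⊢
    convert hlo using 1
    conv_lhs => enter [1, 1, 2]; rw [hfix']
    module
  have hS' := hst.sigma_nonneg
  have d1 : D.sigma (L + Δ) ≤ (2 : ℝ) • D.sigma L := by
    rw [← sub_nonneg]
    convert add_nonneg (smul_nonneg_matrix (show (0 : ℝ) ≤ 2 by norm_num) c1)
      (smul_nonneg_matrix (show 0 ≤ 1 - 2 * κ by linarith) hS') using 1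
    module
  have d2 : κ • D.sigma (L + Δ) ≤ (2 * κ * s) • 1 := by
    refine (smul_mono_matrix hκ0 d1).trans ?_
    rw [mul_comm 2 κ, mul_assoc, mul_smul, mul_smul]
    exact smul_mono_matrix hκ0 (smul_mono_matrix (by norm_num) (h.sigma_le hs))
  refine ⟨hst, d1, ?_, ?_⟩
  · rw [← sub_nonneg] at d2 ⊢
    convert add_nonneg c1 d2 using 1
    module
  · rw [← sub_nonneg] at d2 ⊢
    convert add_nonneg c2 d2 using 1
    module

end MomentModel
end

/-! ### Gradient domination, descent, differentiability and minimizers -/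

section
open scoped MatrixOrder

namespace MomentModel

variable {n m : Type*} [Fintype n] [Fintype m] [DecidableEq n] [DecidableEq m]
  {D : MomentModel n m} {L Δ : Matrix m n ℝ}

variable (D) in
/-- The gradient `2 E Σ_L` of the cost, where `E` is the residual. -/
noncomputable def gradMat (L : Matrix m n ℝ) : Matrix m n ℝ :=
  (2 : ℝ) • (D.residual L * D.sigma L)

variable (D) in
/-- A quarter of the squared Frobenius norm of the gradient. -/
noncomputable def gradSq (L : Matrix m n ℝ) : ℝ :=
  ((D.residual L * D.sigma L)ᵀ * (D.residual L * D.sigma L)).trace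

theorem Stable.gradSq_eq (h : D.Stable L) :
    D.gradSq L = (D.residual L * (D.sigma L * D.sigma L) * (D.residual L)ᵀ).trace := by
  rw [gradSq, Matrix.trace_mul_comm, Matrix.transpose_mul,
    (isSymm_of_nonneg h.sigma_nonneg).eq]
  simp only [Matrix.mul_assoc]

theorem gradSq_nonneg : 0 ≤ D.gradSq L := trace_nonneg_of_nonneg (transpose_mul_nonneg _)

theorem Stable.mu_sq_mul_le_gradSq (h : D.Stable L) :
    D.mu ^ 2 * ((D.residual L)ᵀ * D.residual L).trace ≤ D.gradSq L := by
  have h1 : D.mu ^ 2 • 1 ≤ D.sigma L * D.sigma L := by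
    have hz := sub_nonneg.2 h.mu_le_sigma
    have hz2 := transpose_mul_nonneg (D.sigma L - D.mu • 1)
    rw [(isSymm_of_nonneg hz).eq] at hz2
    rw [← sub_nonneg]
    convert add_nonneg hz2 (smul_nonneg_matrix (show 0 ≤ 2 * D.mu by linarith [D.mu_pos]) hz)
      using 1
    simp only [Matrix.sub_mul, Matrix.mul_sub, Matrix.mul_smul, Matrix.smul_mul, Matrix.mul_one,
      Matrix.one_mul]
    module
  have h2 := trace_mono (conj_mono h1 (D.residual L))
  rw [h.gradSq_eq]
  simpa [Matrix.trace_mul_comm (D.residual L)] using h2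

theorem Stable.gradSq_le (h : D.Stable L) {s p ρ : ℝ} (hs : (D.sigma L).trace ≤ s)
    (hp : (D.value L).trace ≤ p) (hρ : 0 < ρ) (hR : D.inputMat (D.value L) ≤ ρ • 1) :
    D.gradSq L ≤ ρ * p * s ^ 2 := by
  have hs0 : 0 ≤ (D.sigma L).trace := trace_nonneg_of_nonneg h.sigma_nonneg
  have hp0 : 0 ≤ p := (trace_nonneg_of_nonneg h.value_nonneg).trans hp
  have hsy := isSymm_of_nonneg h.sigma_nonneg
  have h1 : (D.residual L)ᵀ * D.residual L ≤ (ρ * p) • 1 := by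
    refine (h.residual_gram_le hρ hR).trans ?_
    rw [mul_smul]
    exact smul_mono_matrix hρ.le (h.value_le hp)
  have h2 := trace_mono (conj_mono h1 (D.sigma L))
  have h3 := trace_mul_mono_left (h.sigma_le hs) h.sigma_nonneg
  simp only [hsy.eq, Matrix.mul_smul, Matrix.mul_one, Matrix.smul_mul, Matrix.one_mul,
    Matrix.trace_smul, smul_eq_mul] at h2 h3
  have h4 : D.gradSq L = (D.sigma L * ((D.residual L)ᵀ * D.residual L) * D.sigma L).trace := by
    rw [gradSq, Matrix.transpose_mul, hsy.eq]
    simp only [Matrix.mul_assoc]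
  rw [h4]
  refine h2.trans (mul_le_mul_of_nonneg_left ?_ (by positivity))
  nlinarith

/-- Gradient domination: the suboptimality with respect to any stable competitor is bounded by
the squared norm of the gradient. -/
theorem Stable.gradient_dominated (h : D.Stable L) {L' : Matrix m n ℝ} (h' : D.Stable L') {σ : ℝ}
    (hσ : D.sigma L' ≤ σ • 1) (hσ0 : 0 < σ) :
    D.mu ^ 2 * D.sR / σ * (D.cost L - D.cost L') ≤ D.gradSq L := by
  have hL' : L' = L + (L' - L) := by abel
  have h1 := h.cost_sub_le (Δ := L' - L) (by rwa [← hL'])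
  rw [← hL'] at h1
  have h2 := trace_mul_mono_left hσ (transpose_mul_nonneg (D.residual L))
  have h3 := h.mu_sq_mul_le_gradSq
  simp only [Matrix.smul_mul, Matrix.one_mul, Matrix.trace_smul, smul_eq_mul] at h2
  rw [le_div_iff₀ D.sR_pos] at h1
  have h4 : D.mu ^ 2 * ((D.cost L - D.cost L') * D.sR) ≤
      D.mu ^ 2 * (σ * ((D.residual L)ᵀ * D.residual L).trace) :=
    mul_le_mul_of_nonneg_left (h1.trans h2) (sq_nonneg _)
  rw [div_mul_eq_mul_div, div_le_iff₀ hσ0]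
  nlinarith

theorem Stable.cost_sub_eq_add_remainder (h : D.Stable L) (h' : D.Stable (L + Δ)) :
    D.cost (L + Δ) - D.cost L = 2 * (D.residual L * D.sigma L * Δᵀ).trace +
      (2 * (D.residual L * (D.sigma (L + Δ) - D.sigma L) * Δᵀ).trace +
      (D.sigma (L + Δ) * (Δᵀ * D.inputMat (D.value L) * Δ)).trace) := by
  rw [h.cost_sub h', Matrix.mul_sub, Matrix.sub_mul, Matrix.trace_sub]
  ring

theorem Stable.trace_second_order_le (h : D.Stable L) {s ρ : ℝ} (hs : (D.sigma L).trace ≤ s)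
    (h2 : D.sigma (L + Δ) ≤ (2 : ℝ) • D.sigma L)
    (hR : D.inputMat (D.value L) ≤ ρ • 1) (H : Matrix m n ℝ) :
    (D.sigma (L + Δ) * (Hᵀ * D.inputMat (D.value L) * H)).trace ≤
      2 * s * ρ * (Hᵀ * H).trace := by
  have hR0 : 0 ≤ D.inputMat (D.value L) :=
    (smul_nonneg_matrix D.sR_pos.le one_nonneg_matrix).trans (sR_le_inputMat h.value_nonneg)
  have hs0 : 0 ≤ s := (trace_nonneg_of_nonneg h.sigma_nonneg).trans hs
  have h3 : D.sigma (L + Δ) ≤ (2 * s) • 1 := by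
    refine h2.trans ?_
    rw [mul_smul]
    exact smul_mono_matrix (by norm_num) (h.sigma_le hs)
  have h4 : 0 ≤ Hᵀ * D.inputMat (D.value L) * H := by
    simpa using conj_nonneg hR0 Hᵀ
  have h5 := trace_mul_mono_left h3 h4
  have h6 := trace_mono (conj_transpose_mono hR H)
  simp only [Matrix.smul_mul, Matrix.one_mul, Matrix.mul_smul, Matrix.mul_one,
    Matrix.trace_smul, smul_eq_mul] at h5 h6
  refine h5.trans ?_
  rw [mul_assoc (2 * s)]
  exact mul_le_mul_of_nonneg_left h6 (by positivity)

/-- One step of gradient descent decreases the cost, for step sizes that are small relative to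
bounds on the aggregate second moments, the value matrix and the input matrix. -/
theorem Stable.descent (h : D.Stable L) {s p ρ η : ℝ} (hs : (D.sigma L).trace ≤ s)
    (hp : (D.value L).trace ≤ p) (hρ : 0 < ρ) (hR : D.inputMat (D.value L) ≤ ρ • 1)
    (hmus : D.mu ≤ s) (hη : 0 < η) (hη1 : 8 * η * ρ * s ≤ 1)
    (hη2 : D.b * (4 * η ^ 2 * (ρ * p * s ^ 2)) ≤ (D.mu ^ 2 / (24 * s ^ 2)) ^ 2) :
    D.Stable (L - η • D.gradMat L) ∧
      D.cost (L - η • D.gradMat L) - D.cost L ≤ -(2 * η * D.gradSq L) := by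
  have hmu := D.mu_pos
  have hs0 : 0 < s := hmu.trans_le hmus
  set H := D.residual L * D.sigma L with hH
  have hg : D.gradSq L = (Hᵀ * H).trace := rfl
  have hstep : L - η • D.gradMat L = L + (-(2 * η)) • H := by
    rw [gradMat]; module
  rw [hstep]
  set Δ : Matrix m n ℝ := (-(2 * η)) • H with hΔ
  have hΔt : (Δᵀ * Δ).trace = 4 * η ^ 2 * D.gradSq L := by
    rw [hg, hΔ]
    simp only [Matrix.transpose_smul, Matrix.smul_mul, Matrix.mul_smul, Matrix.trace_smul,
      smul_eq_mul]
    ring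
  have hgle := h.gradSq_le hs hp hρ hR
  -- With `κ = mu / (8 s)` the matrices `Σ_{L + Δ}` and `Σ_L` differ by at most `mu / 4`, and then
  -- the cross term below costs at most a quarter of the leading term `4 η gradSq L`.
  obtain ⟨hst, h2, hz1, hz2⟩ := h.perturb (Δ := Δ) (τ := D.mu ^ 2 / (24 * s ^ 2))
    (κ := D.mu / (8 * s)) hs (by positivity)
    (by
      rw [div_le_one (by positivity)]
      nlinarith)
    (by
      rw [hΔt]
      refine le_trans ?_ hη2
      exact mul_le_mul_of_nonneg_left (mul_le_mul_of_nonneg_left hgle (by positivity)) D.b_pos.le)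
    (by
      apply le_of_eq
      field_simp
      norm_num)
    (by
      rw [div_le_div_iff₀ (by positivity) (by norm_num)]
      linarith)
  refine ⟨hst, ?_⟩
  have hζ : 2 * (D.mu / (8 * s)) * s = D.mu / 4 := by
    field_simp
    norm_num
  rw [hζ] at hz1 hz2
  have hcross := trace_mul_mul_transpose_le hmu hz1 hz2 (D.residual L) H
  rw [← hg] at hcross
  have hcross2 : |(D.residual L * (D.sigma (L + Δ) - D.sigma L) * Hᵀ).trace| ≤
      D.gradSq L / 4 := by
    refine hcross.trans ?_
    have e : D.mu / 4 / (2 * D.mu) = 1 / 8 := by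
      field_simp
      norm_num
    rw [e]
    linarith [h.mu_sq_mul_le_gradSq]
  have hsecond := h.trace_second_order_le hs h2 hR H
  rw [← hg] at hsecond
  rw [h.cost_sub_eq_add_remainder hst]
  have t1 : (D.residual L * D.sigma L * Δᵀ).trace = -(2 * η) * D.gradSq L := by
    rw [hΔ, ← hH, hg, Matrix.transpose_smul, Matrix.mul_smul, Matrix.trace_smul, smul_eq_mul,
      Matrix.trace_mul_comm]
  have t2 : (D.residual L * (D.sigma (L + Δ) - D.sigma L) * Δᵀ).trace =
      -(2 * η) * (D.residual L * (D.sigma (L + Δ) - D.sigma L) * Hᵀ).trace := by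
    conv_lhs => enter [1, 2]; rw [hΔ]
    rw [Matrix.transpose_smul, Matrix.mul_smul, Matrix.trace_smul, smul_eq_mul]
  have t3 : (D.sigma (L + Δ) * (Δᵀ * D.inputMat (D.value L) * Δ)).trace =
      4 * η ^ 2 * (D.sigma (L + Δ) * (Hᵀ * D.inputMat (D.value L) * H)).trace := by
    conv_lhs => enter [1, 2]; rw [hΔ]
    simp only [Matrix.transpose_smul, Matrix.smul_mul, Matrix.mul_smul, Matrix.trace_smul,
      smul_eq_mul]
    ring
  rw [t1, t2, t3]
  have hg0 := gradSq_nonneg (D := D) (L := L)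
  have u1 := mul_le_mul_of_nonneg_left (abs_le.1 hcross2).1 (show 0 ≤ 4 * η by positivity)
  have u2 := mul_le_mul_of_nonneg_left hsecond (show 0 ≤ 4 * η ^ 2 by positivity)
  have u3 := mul_le_mul_of_nonneg_right hη1 (show 0 ≤ η * D.gradSq L by positivity)
  nlinarith

/-- Feedback matrices close to a stable one are stable, uniformly on sets of bounded aggregate
second moment. -/
theorem exists_stable_radius (D : MomentModel n m) (s : ℝ) : ∃ ε > 0, ∀ L Δ : Matrix m n ℝ,
    D.Stable L → (D.sigma L).trace ≤ s → (Δᵀ * Δ).trace ≤ ε → D.Stable (L + Δ) := by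
  have hmu := D.mu_pos
  have hb := D.b_pos
  set s' := max s 1
  have hs' : 0 < s' := lt_max_of_lt_right one_pos
  set τ := min 1 (D.mu / (6 * s')) with hτ
  have hτ0 : 0 < τ := lt_min one_pos (by positivity)
  refine ⟨τ ^ 2 / D.b, by positivity, fun L Δ h hs hΔ => ?_⟩
  refine (h.perturb (κ := 1 / 2) (hs.trans (le_max_left s 1)) hτ0 (min_le_left _ _) ?_ ?_
    le_rfl).1
  · rwa [le_div_iff₀' hb] at hΔ
  · have : τ ≤ D.mu / (6 * s') := min_le_right _ _
    rw [le_div_iff₀ (by positivity)] at this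
    change 3 * s' * τ ≤ _
    linarith

/-- The first order expansion of the cost with a quadratic remainder. -/
theorem Stable.exists_remainder_bound (h : D.Stable L) : ∃ C > 0, ∃ ε > 0,
    ∀ Δ : Matrix m n ℝ, (Δᵀ * Δ).trace ≤ ε → D.Stable (L + Δ) ∧
      |D.cost (L + Δ) - D.cost L - 2 * (D.residual L * D.sigma L * Δᵀ).trace| ≤
        C * (Δᵀ * Δ).trace := by
  have hmu := D.mu_pos
  have hb := D.b_pos
  have hs0 : 0 ≤ (D.sigma L).trace := trace_nonneg_of_nonneg h.sigma_nonneg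
  have hp0 : 0 ≤ (D.value L).trace := trace_nonneg_of_nonneg h.value_nonneg
  set s := (D.sigma L).trace + 1 with hs
  have hspos : 0 < s := by positivity
  set ρ := D.r + D.b * (D.value L).trace with hρ
  have hρ0 : 0 ≤ ρ := add_nonneg D.r_nonneg (by positivity)
  have hR : D.inputMat (D.value L) ≤ ρ • 1 := inputMat_le (h.value_le le_rfl) hp0
  set e := ((D.residual L)ᵀ * D.residual L).trace with he
  have he0 : 0 ≤ e := trace_nonneg_of_nonneg (transpose_mul_nonneg _)
  set τ := min 1 (D.mu / (6 * s)) with hτ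
  have hτ0 : 0 < τ := lt_min one_pos (by positivity)
  refine ⟨6 * s ^ 2 * √D.b / D.mu * (e + 1) + 2 * s * ρ, by positivity, τ ^ 2 / D.b,
    by positivity, fun Δ hΔ => ?_⟩
  rcases eq_or_ne Δ 0 with rfl | hne
  · simpa using h
  have hd0 : 0 ≤ (Δᵀ * Δ).trace := trace_nonneg_of_nonneg (transpose_mul_nonneg _)
  have hd : 0 < (Δᵀ * Δ).trace := by
    refine lt_of_le_of_ne hd0 fun h0 => hne ?_
    exact eq_zero_of_trace_nonpos h0.symm.le
  set δ := √(Δᵀ * Δ).trace with hδ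
  have hδ0 : 0 < δ := Real.sqrt_pos.2 hd
  have hδ2 : δ ^ 2 = (Δᵀ * Δ).trace := Real.sq_sqrt hd0
  have hbs : √D.b ^ 2 = D.b := Real.sq_sqrt hb.le
  have hbpos : 0 < √D.b := Real.sqrt_pos.2 hb
  have hτ2 : √D.b * δ ≤ τ := by
    refine (sq_le_sq₀ (by positivity) hτ0.le).1 ?_
    rw [mul_pow, hbs, hδ2]
    rwa [le_div_iff₀' hb] at hΔ
  have hτs : √D.b * δ ≤ D.mu / (6 * s) := hτ2.trans (min_le_right _ _)
  rw [le_div_iff₀ (by positivity)] at hτs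
  obtain ⟨hst, h2, hz1, hz2⟩ := h.perturb (Δ := Δ) (s := s) (τ := √D.b * δ)
    (κ := 3 * s * (√D.b * δ) / D.mu) (by linarith) (by positivity)
    (hτ2.trans (min_le_left _ _)) (by rw [mul_pow, hbs, hδ2])
    (by rw [div_mul_cancel₀ _ hmu.ne'])
    (by rw [div_le_iff₀ hmu]; linarith)
  refine ⟨hst, ?_⟩
  have hcross := trace_mul_mul_transpose_le hδ0 hz1 hz2 (D.residual L) Δ
  have hsecond := h.trace_second_order_le (s := s) (by linarith) h2 hR Δ
  have hR0 : 0 ≤ D.inputMat (D.value L) :=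
    (smul_nonneg_matrix D.sR_pos.le one_nonneg_matrix).trans (sR_le_inputMat h.value_nonneg)
  have hsecond0 : 0 ≤ (D.sigma (L + Δ) * (Δᵀ * D.inputMat (D.value L) * Δ)).trace :=
    trace_mul_nonneg hst.sigma_nonneg (by simpa using conj_nonneg hR0 Δᵀ)
  rw [h.cost_sub_eq_add_remainder hst, add_sub_cancel_left]
  refine (abs_add_le _ _).trans ?_
  rw [abs_of_nonneg hsecond0, abs_mul, abs_two, add_mul]
  refine add_le_add ?_ hsecond
  refine (mul_le_mul_of_nonneg_left hcross (by norm_num)).trans (le_of_eq ?_)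
  rw [← he, ← hδ2]
  field_simp
  ring

theorem trace_le_card_mul_norm_sq (Δ : Matrix m n ℝ) :
    (Δᵀ * Δ).trace ≤ Fintype.card m * Fintype.card n * ‖Δ‖ ^ 2 := by
  rw [trace_transpose_mul_self]
  have : ∀ i j, Δ i j ^ 2 ≤ ‖Δ‖ ^ 2 := fun i j => by
    rw [← sq_abs]
    exact pow_le_pow_left₀ (abs_nonneg _) (LQSystem.abs_entry_le_norm Δ i j) 2
  refine (Finset.sum_le_sum fun i _ => Finset.sum_le_sum fun j _ => this i j).trans ?_
  simp [mul_assoc]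

/-- The Frobenius pairing `Δ ↦ tr (W Δᵀ)` as a continuous linear functional. -/
noncomputable def pairing (W : Matrix m n ℝ) : Matrix m n ℝ →L[ℝ] ℝ :=
  LinearMap.toContinuousLinearMap
    { toFun := fun Δ => (W * Δᵀ).trace
      map_add' := by simp [Matrix.mul_add]
      map_smul' := by simp }

theorem pairing_apply (W Δ : Matrix m n ℝ) : pairing W Δ = (W * Δᵀ).trace := rfl

theorem pairing_single (W : Matrix m n ℝ) (i : m) (j : n) :
    pairing W (Matrix.single i j 1) = W i j := by
  rw [pairing_apply, Matrix.transpose_single, Matrix.trace_mul_single]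
  simp

theorem Stable.hasFDerivAt (h : D.Stable L) :
    HasFDerivAt D.cost (pairing (D.gradMat L)) L := by
  obtain ⟨C, hC, ε, hε, hrem⟩ := h.exists_remainder_bound
  rw [hasFDerivAt_iff_isLittleO_nhds_zero]
  set c : ℝ := Fintype.card m * Fintype.card n
  have hc : 0 ≤ c := by positivity
  have hbig : (fun Δ : Matrix m n ℝ => D.cost (L + Δ) - D.cost L - pairing (D.gradMat L) Δ)
      =O[𝓝 0] fun Δ => ‖Δ‖ ^ 2 := by
    refine Asymptotics.IsBigO.of_bound (C * c) ?_
    have hcont : Tendsto (fun Δ : Matrix m n ℝ => c * ‖Δ‖ ^ 2) (𝓝 0) (𝓝 0) := by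
      have : Continuous fun Δ : Matrix m n ℝ => c * ‖Δ‖ ^ 2 := by fun_prop
      simpa using this.tendsto 0
    filter_upwards [hcont.eventually (gt_mem_nhds hε)] with Δ hΔ
    have h1 := (hrem Δ ((trace_le_card_mul_norm_sq Δ).trans hΔ.le)).2
    rw [pairing_apply, gradMat, Matrix.smul_mul, Matrix.trace_smul, smul_eq_mul,
      Real.norm_eq_abs, norm_pow, norm_norm, mul_assoc]
    exact h1.trans (mul_le_mul_of_nonneg_left (trace_le_card_mul_norm_sq Δ) hC.le)
  refine hbig.trans_isLittleO ?_
  have := Asymptotics.isLittleO_norm_pow_id (E' := Matrix m n ℝ) (n := 2) (by norm_num)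
  exact this

theorem Stable.eventually_stable (h : D.Stable L) : ∀ᶠ L' in 𝓝 L, D.Stable L' := by
  obtain ⟨ε, hε, hst⟩ := exists_stable_radius D (D.sigma L).trace
  have hcont : Continuous fun L' : Matrix m n ℝ => ((L' - L)ᵀ * (L' - L)).trace := by fun_prop
  have := hcont.tendsto L
  simp only [sub_self, Matrix.transpose_zero, Matrix.mul_zero, Matrix.trace_zero] at this
  filter_upwards [this.eventually (gt_mem_nhds hε)] with L' hL'
  simpa using hst L (L' - L) h le_rfl hL'.le

/-- Sublevel sets of the cost are bounded by coercivity, and closed because the radius of stability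
is uniform on them. -/
theorem isCompact_sublevel (D : MomentModel n m) (c : ℝ) :
    IsCompact {L : Matrix m n ℝ | D.Stable L ∧ D.cost L ≤ c} := by
  have hbox : IsCompact (Set.univ.pi fun _ : m => Set.univ.pi fun _ : n =>
      Set.Icc (-√(c / (D.mu * D.sR))) √(c / (D.mu * D.sR))) :=
    isCompact_univ_pi fun _ => isCompact_univ_pi fun _ => isCompact_Icc
  refine IsCompact.of_isClosed_subset hbox ?_ ?_
  · refine isClosed_of_closure_subset fun L hL => ?_
    obtain ⟨u, hu, hlim⟩ := mem_closure_iff_seq_limit.1 hL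
    obtain ⟨ε, hε, hst⟩ := exists_stable_radius D (c / D.sQ)
    have hcont : Continuous fun L' : Matrix m n ℝ => ((L - L')ᵀ * (L - L')).trace := by fun_prop
    have h0 := hcont.tendsto L
    simp only [sub_self, Matrix.transpose_zero, Matrix.mul_zero, Matrix.trace_zero] at h0
    obtain ⟨k, hk⟩ := ((h0.comp hlim).eventually (gt_mem_nhds hε)).exists
    have hsk : (D.sigma (u k)).trace ≤ c / D.sQ := by
      rw [le_div_iff₀' D.sQ_pos]
      exact (hu k).1.sQ_mul_trace_sigma_le.trans (hu k).2
    have hL : D.Stable L := by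
      simpa using hst (u k) (L - u k) (hu k).1 hsk hk.le
    exact ⟨hL, le_of_tendsto' (hL.hasFDerivAt.continuousAt.tendsto.comp hlim) fun k => (hu k).2⟩
  · rintro L ⟨hL, hc⟩
    have h1 := hL.coercive
    have hpos : 0 < D.mu * D.sR := mul_pos D.mu_pos D.sR_pos
    intro i _ j _
    rw [Set.mem_Icc, ← abs_le]
    refine Real.abs_le_sqrt ?_
    rw [le_div_iff₀' hpos]
    refine le_trans (mul_le_mul_of_nonneg_left ?_ hpos.le) (h1.trans hc)
    exact sq_apply_le_trace L i j

theorem exists_minimizer (D : MomentModel n m) (hD : ∃ L, D.Stable L) :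
    ∃ L, D.Stable L ∧ ∀ L', D.Stable L' → D.cost L ≤ D.cost L' := by
  obtain ⟨L₁, h₁⟩ := hD
  obtain ⟨L, hL, hmin⟩ := (isCompact_sublevel D (D.cost L₁)).exists_isMinOn
    ⟨L₁, h₁, le_rfl⟩ (f := D.cost)
    (fun L hL => hL.1.hasFDerivAt.continuousAt.continuousWithinAt)
  refine ⟨L, hL.1, fun L' h' => ?_⟩
  rcases le_total (D.cost L') (D.cost L₁) with hle | hle
  · exact hmin ⟨h', hle⟩
  · exact hL.2.trans hle

theorem residual_eq_zero_of_minimizer (h : D.Stable L)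
    (hmin : ∀ L', D.Stable L' → D.cost L ≤ D.cost L') : D.residual L = 0 := by
  have hloc : IsLocalMin D.cost L := by
    filter_upwards [h.eventually_stable] with L' h'
    exact hmin L' h'
  have h0 := hloc.hasFDerivAt_eq_zero h.hasFDerivAt
  have h1 : pairing (D.gradMat L) (D.residual L * D.sigma L) = 0 := by rw [h0]; rfl
  have h2 : D.gradSq L = 0 := by
    rw [pairing_apply, gradMat, Matrix.smul_mul, Matrix.trace_smul, Matrix.trace_mul_comm] at h1
    rw [gradSq]
    simpa using h1
  have h3 := h.mu_sq_mul_le_gradSq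
  rw [h2] at h3
  exact eq_zero_of_trace_nonpos (nonpos_of_mul_nonpos_right h3 (pow_pos D.mu_pos 2))

/-- Quadratic growth of the cost around a minimizer. -/
theorem quadratic_growth (h : D.Stable L)
    (hmin : ∀ L', D.Stable L' → D.cost L ≤ D.cost L') {L' : Matrix m n ℝ} (h' : D.Stable L') :
    D.mu * D.sR * ((L' - L)ᵀ * (L' - L)).trace ≤ D.cost L' - D.cost L := by
  have hE := residual_eq_zero_of_minimizer h hmin
  have hL' : L' = L + (L' - L) := by abel
  have hd := h.cost_sub (Δ := L' - L) (by rwa [← hL'])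
  rw [← hL', hE] at hd
  simp only [Matrix.zero_mul, Matrix.trace_zero, mul_zero, zero_add] at hd
  rw [hd]
  have hR := sR_le_inputMat (D := D) h.value_nonneg
  have hR0 : 0 ≤ D.inputMat (D.value L) :=
    (smul_nonneg_matrix D.sR_pos.le one_nonneg_matrix).trans hR
  have h1 := trace_mul_mono_left h'.mu_le_sigma
    (show 0 ≤ (L' - L)ᵀ * D.inputMat (D.value L) * (L' - L) by
      simpa using conj_nonneg hR0 (L' - L)ᵀ)
  have h2 := trace_mono (conj_transpose_mono hR (L' - L))
  simp only [Matrix.smul_mul, Matrix.one_mul, Matrix.mul_smul, Matrix.mul_one,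
    Matrix.trace_smul, smul_eq_mul] at h1 h2
  refine le_trans ?_ h1
  rw [mul_assoc]
  exact mul_le_mul_of_nonneg_left h2 D.mu_pos.le

end MomentModel
end

/-! ### Step sizes and linear convergence -/

/-- The constant in the admissible step size; `b` and `r` bound the second moment of the input
matrix and the mean of the control cost matrix. -/
noncomputable def stepConst (b r sQ mu : ℝ) : ℝ :=
  min (sQ / (8 * (r + b / mu))) √(mu ^ 5 * sQ ^ 6 / (2304 * b * (r + b / mu)))

theorem stepConst_pos {b r sQ mu : ℝ} (hb : 0 < b) (hr : 0 ≤ r) (hsQ : 0 < sQ) (hmu : 0 < mu) :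
    0 < stepConst b r sQ mu := by
  have : 0 < r + b / mu := by positivity
  exact lt_min (by positivity) (Real.sqrt_pos.2 (by positivity))

section
open scoped MatrixOrder
namespace MomentModel

variable {n m : Type*} [Fintype n] [Fintype m] [DecidableEq n] [DecidableEq m]
  {D : MomentModel n m} {L Δ : Matrix m n ℝ}

/-- The descent step with the bounds on the aggregate second moments (`s = y / sQ`), the value
matrix (`p = y / mu`) and the input matrix (`ρ = r + b p`) expressed through `y = 1 + c₀`, where
`c₀` bounds the cost. -/
theorem Stable.descent_of_le_stepConst [Nonempty n] (h : D.Stable L) {c₀ η : ℝ}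
    (hc : D.cost L ≤ c₀) (hη : 0 < η)
    (hη1 : η ≤ stepConst D.b D.r D.sQ D.mu * (1 + c₀) ^ (-5 : ℤ)) :
    D.Stable (L - η • D.gradMat L) ∧
      D.cost (L - η • D.gradMat L) - D.cost L ≤ -(2 * η * D.gradSq L) := by
  have hmu := D.mu_pos
  have hb := D.b_pos
  have hr := D.r_nonneg
  have hsQ := D.sQ_pos
  have hy : 1 ≤ 1 + c₀ := by linarith [h.cost_nonneg]
  set y := 1 + c₀ with hydef
  have hy0 : 0 < y := by linarith
  set g := D.r + D.b / D.mu with hg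
  have hg0 : 0 < g := by positivity
  have hs : (D.sigma L).trace ≤ y / D.sQ := by
    rw [le_div_iff₀' hsQ]
    linarith [h.sQ_mul_trace_sigma_le]
  have hp : (D.value L).trace ≤ y / D.mu := by
    rw [le_div_iff₀' hmu]
    linarith [h.mu_mul_trace_value_le]
  have hR : D.inputMat (D.value L) ≤ (g * y) • 1 := by
    refine (inputMat_le (h.value_le hp) (by positivity)).trans
      (smul_mono_scalar one_nonneg_matrix ?_)
    have : g * y - (D.r + D.b * (y / D.mu)) = D.r * (y - 1) := by
      rw [hg]; field_simp; ring
    nlinarith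
  have hmus : D.mu ≤ y / D.sQ := by
    have h1 := trace_mono h.mu_le_sigma
    rw [Matrix.trace_smul, Matrix.trace_one, smul_eq_mul] at h1
    have h2 : (1 : ℝ) ≤ Fintype.card n := by exact_mod_cast Fintype.card_pos
    nlinarith
  have hk : 0 < stepConst D.b D.r D.sQ D.mu := stepConst_pos hb hr hsQ hmu
  have hpow : ∀ k : ℕ, k ≤ 5 → η * y ^ k ≤ stepConst D.b D.r D.sQ D.mu := by
    intro k hk5
    have h1 : η * y ^ 5 ≤ stepConst D.b D.r D.sQ D.mu := by
      rw [zpow_neg, ← div_eq_mul_inv] at hη1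
      rw [le_div_iff₀ (by positivity)] at hη1
      exact_mod_cast hη1
    exact (mul_le_mul_of_nonneg_left (pow_le_pow_right₀ hy hk5) hη.le).trans h1
  refine h.descent hs hp (by positivity) hR hmus hη ?_ ?_
  · have h1 := (hpow 2 (by norm_num)).trans (min_le_left _ _)
    rw [← hg, le_div_iff₀ (by positivity)] at h1
    have : 8 * η * (g * y) * (y / D.sQ) = η * y ^ 2 * (8 * g) / D.sQ := by
      field_simp
    rw [this, div_le_one hsQ]
    exact h1
  · have h1 := (hpow 4 (by norm_num)).trans (min_le_right _ _)
    rw [← hg] at h1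
    have h2 := pow_le_pow_left₀ (by positivity) h1 2
    rw [Real.sq_sqrt (by positivity), le_div_iff₀ (by positivity)] at h2
    have e1 : D.b * (4 * η ^ 2 * (g * y * (y / D.mu) * (y / D.sQ) ^ 2)) =
        (η * y ^ 4) ^ 2 * (2304 * D.b * g) / (576 * D.mu * D.sQ ^ 2 * y ^ 4) := by
      field_simp
      norm_num
    have e2 : (D.mu ^ 2 / (24 * (y / D.sQ) ^ 2)) ^ 2 =
        D.mu ^ 5 * D.sQ ^ 6 / (576 * D.mu * D.sQ ^ 2 * y ^ 4) := by
      field_simp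
      norm_num
    rw [e1, e2]
    exact div_le_div_of_nonneg_right h2 (by positivity)

end MomentModel
end

/-- Linear convergence of a nonnegative sequence from a one step contraction estimate; the factor
`1 - a` may be negative, in which case the sequence vanishes. -/
theorem le_exp_mul_of_contraction {e : ℕ → ℝ} {a : ℝ} (he : ∀ k, 0 ≤ e k)
    (h : ∀ k, e (k + 1) ≤ (1 - a) * e k) (k : ℕ) : e k ≤ Real.exp (-(a * k)) * e 0 := by
  induction k with
  | zero => simp
  | succ k ih =>
    have h1 : 1 - a ≤ Real.exp (-a) := by
      have := Real.add_one_le_exp (-a)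
      linarith
    calc e (k + 1) ≤ (1 - a) * e k := h k
      _ ≤ Real.exp (-a) * e k := mul_le_mul_of_nonneg_right h1 (he k)
      _ ≤ Real.exp (-a) * (Real.exp (-(a * k)) * e 0) :=
        mul_le_mul_of_nonneg_left ih (Real.exp_pos _).le
      _ = Real.exp (-(a * (k + 1 : ℕ))) * e 0 := by
        rw [← mul_assoc, ← Real.exp_add]
        congr 2
        push_cast
        ring

/-- The iteration count after which a contracting sequence falls below `ε`. -/
theorem lt_of_contraction {e : ℕ → ℝ} {a ε : ℝ} (he : ∀ k, 0 ≤ e k) (ha : 0 < a)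
    (h : ∀ k, e (k + 1) ≤ (1 - a) * e k) (hε : 0 < ε) {k : ℕ} (hk : 1 ≤ k)
    (hlog : Real.log (e 0 / ε) ≤ a * k) : e k < ε := by
  rcases (he 0).eq_or_lt with h0 | h0
  · have := le_exp_mul_of_contraction he h k
    rw [← h0, mul_zero] at this
    exact this.trans_lt hε
  obtain ⟨j, rfl⟩ := Nat.exists_eq_add_of_le' hk
  -- Strictness comes from the first step, where `1 - a < exp (-a)`.
  have h1 : e 1 < Real.exp (-a) * e 0 := by
    refine (h 0).trans_lt (mul_lt_mul_of_pos_right ?_ h0)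
    have := Real.add_one_lt_exp (neg_ne_zero.2 ha.ne')
    linarith
  have h2 := le_exp_mul_of_contraction (e := fun k => e (k + 1)) (fun k => he _)
    (fun k => h _) j
  have h3 : e (j + 1) < Real.exp (-(a * (j + 1 : ℕ))) * e 0 := by
    refine h2.trans_lt ((mul_lt_mul_of_pos_left h1 (Real.exp_pos _)).trans_eq ?_)
    rw [← mul_assoc, ← Real.exp_add]
    congr 2
    push_cast
    ring
  refine h3.trans_le ?_
  rw [Real.log_le_iff_le_exp (by positivity), div_le_iff₀ hε] at hlog
  rw [Real.exp_neg, inv_mul_le_iff₀ (Real.exp_pos _)]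
  exact hlog

theorem tendsto_zero_of_contraction {e : ℕ → ℝ} {a : ℝ} (he : ∀ k, 0 ≤ e k) (ha : 0 < a)
    (h : ∀ k, e (k + 1) ≤ (1 - a) * e k) : Tendsto e atTop (𝓝 0) := by
  refine squeeze_zero he (le_exp_mul_of_contraction he h) ?_
  have h1 : Tendsto (fun k : ℕ => a * (k : ℝ)) atTop atTop :=
    tendsto_natCast_atTop_atTop.const_mul_atTop ha
  simpa using (Real.tendsto_exp_neg_atTop_nhds_zero.comp h1).mul_const (e 0)

/-! ### Singular values, random matrices and independence -/

section
open scoped MatrixOrder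

/-- For a positive semidefinite matrix the smallest singular value is a lower bound in the Loewner
order. -/
theorem sigmaMin_smul_one_le {d : ℕ} {M : Matrix (Fin d) (Fin d) ℝ} (hM : M.PosSemidef) :
    sigmaMin M • 1 ≤ M := by
  rw [← sub_nonneg, Matrix.nonneg_iff_posSemidef]
  rw [Matrix.posSemidef_iff_isHermitian_and_spectrum_nonneg]
  refine ⟨hM.1.sub (Matrix.isHermitian_one.smul (by simp [IsSelfAdjoint])), fun μ hμ => ?_⟩
  set T := Matrix.toEuclideanLin M with hT
  have h1 : μ + sigmaMin M ∈ spectrum ℝ M := by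
    have hsub : -(algebraMap ℝ (Matrix (Fin d) (Fin d) ℝ) (sigmaMin M)) + M =
        M - sigmaMin M • 1 := by
      rw [Algebra.algebraMap_eq_smul_one]
      abel
    rw [spectrum.add_mem_iff, hsub]
    exact hμ
  have hnn : 0 ≤ μ + sigmaMin M :=
    (Matrix.posSemidef_iff_isHermitian_and_spectrum_nonneg.1 hM).2 h1
  rw [← Matrix.spectrum_toLpLin 2] at h1
  obtain ⟨v, hv⟩ := (Module.End.HasEigenvalue.of_mem_spectrum h1).exists_hasEigenvector
  have hadj : LinearMap.adjoint T = T := by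
    rw [hT, ← Matrix.toEuclideanLin_conjTranspose_eq_adjoint, hM.1.eq]
  have hv2 : (LinearMap.adjoint T ∘ₗ T) v = ((μ + sigmaMin M) ^ 2) • v := by
    rw [hadj, LinearMap.comp_apply, hv.apply_eq_smul, map_smul, hv.apply_eq_smul, smul_smul, sq]
  have hev : Module.End.HasEigenvalue (LinearMap.adjoint T ∘ₗ T) ((μ + sigmaMin M) ^ 2) :=
    Module.End.hasEigenvalue_of_hasEigenvector ⟨Module.End.mem_eigenspace_iff.2 hv2, hv.2⟩
  have hfin : Module.finrank ℝ (EuclideanSpace ℝ (Fin d)) = d := by simp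
  obtain ⟨i, hi⟩ := T.isSymmetric_adjoint_comp_self.exists_eigenvalues_eq hfin hev
  have h3 : T.singularValues i ^ 2 = (μ + sigmaMin M) ^ 2 := by
    rw [T.sq_singularValues_fin hfin]
    exact hi
  have h4 : sigmaMin M ≤ T.singularValues i :=
    T.singularValues_antitone (by simp only [min_self]; omega)
  have h5 : T.singularValues i = μ + sigmaMin M :=
    (sq_eq_sq₀ (T.singularValues_nonneg _) hnn).1 h3
  change 0 ≤ μ
  linarith

theorem sigmaMin_pos {d : ℕ} (hd : 0 < d) {M : Matrix (Fin d) (Fin d) ℝ} (hM : M.PosDef) :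
    0 < sigmaMin M := by
  have hinj : Function.Injective (Matrix.toEuclideanLin M) := by
    rw [injective_iff_map_eq_zero]
    intro v hv
    by_contra hne
    have h := hM.dotProduct_mulVec_pos (x := v.ofLp) (by simpa using hne)
    have h0 : M *ᵥ v.ofLp = 0 := by
      have := congrArg WithLp.ofLp hv
      simpa [Matrix.toLpLin_apply] using this
    rw [h0] at h
    simp at h
  refine (LinearMap.injective_iff_forall_lt_finrank_singularValues_pos _).1 hinj _ ?_
  simp
  omega

section Expect

variable {Ω : Type*} [MeasurableSpace Ω] {P : Measure Ω}

theorem quadForm_expect {ι : Type*} [Fintype ι] {Z : Ω → Matrix ι ι ℝ}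
    (hZ : ∀ i j, Integrable (fun ω => Z ω i j) P) (v : ι → ℝ) :
    v ⬝ᵥ (expect P Z *ᵥ v) = ∫ ω, v ⬝ᵥ (Z ω *ᵥ v) ∂P := by
  simp only [dotProduct, Matrix.mulVec, expect, Matrix.of_apply]
  rw [integral_finsetSum]
  · refine Finset.sum_congr rfl fun i _ => ?_
    rw [integral_const_mul, integral_finsetSum _ fun j _ => (hZ i j).mul_const _]
    simp only [integral_mul_const]
  · exact fun i _ => (integrable_finsetSum _ fun j _ => (hZ i j).mul_const _).const_mul _

theorem isSymm_expect {ι : Type*} {Z : Ω → Matrix ι ι ℝ} (h : ∀ᵐ ω ∂P, (Z ω).IsSymm) :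
    (expect P Z).IsSymm := by
  ext i j
  simp only [expect, Matrix.transpose_apply, Matrix.of_apply]
  refine integral_congr_ae ?_
  filter_upwards [h] with ω hω
  exact hω.apply i j

theorem expect_nonneg {ι : Type*} [Fintype ι] [DecidableEq ι] {Z : Ω → Matrix ι ι ℝ}
    (hZ : ∀ i j, Integrable (fun ω => Z ω i j) P) (h : ∀ᵐ ω ∂P, 0 ≤ Z ω) : 0 ≤ expect P Z := by
  refine nonneg_iff_quadForm.2 ⟨isSymm_expect ?_, fun v => ?_⟩
  · filter_upwards [h] with ω hω using isSymm_of_nonneg hω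
  · rw [quadForm_expect hZ]
    refine integral_nonneg_of_ae ?_
    filter_upwards [h] with ω hω using (nonneg_iff_quadForm.1 hω).2 v

theorem expect_le_smul_one {ι : Type*} [Fintype ι] [DecidableEq ι] {Z : Ω → Matrix ι ι ℝ}
    (hZ : ∀ i j, Integrable (fun ω => Z ω i j) P) (h : ∀ᵐ ω ∂P, (Z ω).IsSymm)
    {f : Ω → ℝ} (hf : Integrable f P) (hle : ∀ ω v, v ⬝ᵥ (Z ω *ᵥ v) ≤ f ω * (v ⬝ᵥ v)) :
    expect P Z ≤ (∫ ω, f ω ∂P) • 1 := by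
  refine le_smul_one_of_quadForm (isSymm_expect h) fun v => ?_
  rw [quadForm_expect hZ, ← integral_mul_const]
  refine integral_mono ?_ (hf.mul_const _) fun ω => hle ω v
  simp only [dotProduct, Matrix.mulVec]
  exact integrable_finsetSum _ fun i _ =>
    (integrable_finsetSum _ fun j _ => (hZ i j).mul_const _).const_mul _

end Expect

theorem dotProduct_self_eq_norm_sq {ι : Type*} [Fintype ι] (v : ι → ℝ) :
    v ⬝ᵥ v = ‖WithLp.toLp 2 v‖ ^ 2 := by
  rw [EuclideanSpace.real_norm_sq_eq]
  simp [dotProduct, sq]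

theorem mulVec_dotProduct_self_le {ι κ : Type*} [Fintype ι] [Fintype κ] [DecidableEq κ]
    (M : Matrix ι κ ℝ) (v : κ → ℝ) : (M *ᵥ v) ⬝ᵥ (M *ᵥ v) ≤ ‖M‖ ^ 2 * (v ⬝ᵥ v) := by
  rw [dotProduct_self_eq_norm_sq, dotProduct_self_eq_norm_sq, ← mul_pow]
  exact pow_le_pow_left₀ (norm_nonneg _) (Matrix.l2_opNorm_mulVec M (WithLp.toLp 2 v)) 2

theorem quadForm_le_norm_mul {ι : Type*} [Fintype ι] [DecidableEq ι]
    (M : Matrix ι ι ℝ) (v : ι → ℝ) : v ⬝ᵥ (M *ᵥ v) ≤ ‖M‖ * (v ⬝ᵥ v) := by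
  have h1 : v ⬝ᵥ (M *ᵥ v) = inner ℝ (WithLp.toLp 2 (M *ᵥ v)) (WithLp.toLp 2 v) := by
    rw [EuclideanSpace.inner_toLp_toLp]
    simp
  rw [h1, dotProduct_self_eq_norm_sq]
  refine (real_inner_le_norm _ _).trans ?_
  have := Matrix.l2_opNorm_mulVec M (WithLp.toLp 2 v)
  rw [sq, ← mul_assoc]
  exact mul_le_mul_of_nonneg_right this (norm_nonneg _)

theorem measurable_norm_matrix {ι κ : Type*} [Fintype ι] [Fintype κ] [DecidableEq κ] :
    Measurable fun M : Matrix ι κ ℝ => ‖M‖ := by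
  have h : Continuous fun M : Matrix ι κ ℝ => ‖M‖ := continuous_norm
  have hb : BorelSpace (Matrix ι κ ℝ) := inferInstanceAs (BorelSpace (ι → κ → ℝ))
  exact h.measurable

theorem norm_le_of_mulVec {ι κ : Type*} [Fintype ι] [Fintype κ] [DecidableEq κ]
    {M : Matrix ι κ ℝ} {c : ℝ} (hc : 0 ≤ c)
    (h : ∀ v, (M *ᵥ v) ⬝ᵥ (M *ᵥ v) ≤ c ^ 2 * (v ⬝ᵥ v)) : ‖M‖ ≤ c := by
  rw [Matrix.l2_opNorm_def]
  refine ContinuousLinearMap.opNorm_le_bound _ hc fun v => ?_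
  have := h v.ofLp
  rw [dotProduct_self_eq_norm_sq, dotProduct_self_eq_norm_sq, ← mul_pow] at this
  exact (sq_le_sq₀ (norm_nonneg _) (by positivity)).1 this

/-- An independence lemma: if `X` is independent of the pair `(Y, Z)`, and `Y` of `Z`, then the
pair `(X, Y)` is independent of `Z`. -/
theorem indepFun_prodMk_of_indepFun {Ω α β γ : Type*} [MeasurableSpace Ω] [MeasurableSpace α]
    [MeasurableSpace β] [MeasurableSpace γ] {P : Measure Ω} [IsProbabilityMeasure P]
    {X : Ω → α} {Y : Ω → β} {Z : Ω → γ} (hX : Measurable X) (hY : Measurable Y)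
    (hZ : Measurable Z) (h1 : IndepFun X (fun ω => (Y ω, Z ω)) P) (h2 : IndepFun Y Z P) :
    IndepFun (fun ω => (X ω, Y ω)) Z P := by
  have h3 : IndepFun X Y P := h1.comp measurable_id measurable_fst
  rw [indepFun_iff_map_prod_eq_prod_map_map (by fun_prop) (by fun_prop)] at h1 h2 h3 ⊢
  have : IsProbabilityMeasure (P.map X) := Measure.isProbabilityMeasure_map (by fun_prop)
  have : IsProbabilityMeasure (P.map Y) := Measure.isProbabilityMeasure_map (by fun_prop)
  have : IsProbabilityMeasure (P.map Z) := Measure.isProbabilityMeasure_map (by fun_prop)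
  rw [h3]
  have h4 : (fun ω => ((X ω, Y ω), Z ω)) =
      MeasurableEquiv.prodAssoc.symm ∘ fun ω => (X ω, (Y ω, Z ω)) := rfl
  rw [h4, ← Measure.map_map (MeasurableEquiv.measurable _) (by fun_prop), h1, h2,
    ← Measure.prodAssoc_prod, Measure.map_map (MeasurableEquiv.measurable _)
      (MeasurableEquiv.measurable _), MeasurableEquiv.symm_comp_self, Measure.map_id]

end

/-! ### The second moment model of a random linear-quadratic system -/

section
open scoped MatrixOrder

namespace LQSystem

variable {n m : ℕ} {Ω : Type*} [MeasurableSpace Ω] {P : Measure Ω} (S : LQSystem n m P)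

/-- The random parameters acting at time `t`. -/
def param (t : ℕ) (ω : Ω) : Matrix (Fin n) (Fin n) ℝ × Matrix (Fin n) (Fin m) ℝ ×
    Matrix (Fin n) (Fin n) ℝ × Matrix (Fin m) (Fin m) ℝ :=
  (S.A t ω, S.B t ω, S.Q t ω, S.R t ω)

theorem measurable_fromCols_apply (i : Fin n) (a : Fin n ⊕ Fin m) :
    Measurable fun p : Matrix (Fin n) (Fin n) ℝ × Matrix (Fin n) (Fin m) ℝ ×
      Matrix (Fin n) (Fin n) ℝ × Matrix (Fin m) (Fin m) ℝ => Matrix.fromCols p.1 p.2.1 i a := by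
  cases a with
  | inl j => exact (measurable_entry i j).comp measurable_fst
  | inr j => exact (measurable_entry i j).comp (measurable_fst.comp measurable_snd)

theorem measurable_fromBlocks_apply (a b : Fin n ⊕ Fin m) :
    Measurable fun p : Matrix (Fin n) (Fin n) ℝ × Matrix (Fin n) (Fin m) ℝ ×
      Matrix (Fin n) (Fin n) ℝ × Matrix (Fin m) (Fin m) ℝ =>
        Matrix.fromBlocks p.2.2.1 0 0 p.2.2.2 a b := by
  rcases a with i | i <;> rcases b with j | j
  · exact (measurable_entry i j).comp (measurable_fst.comp (measurable_snd.comp measurable_snd))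
  · exact measurable_const
  · exact measurable_const
  · exact (measurable_entry i j).comp (measurable_snd.comp (measurable_snd.comp measurable_snd))

theorem integrable_Λ_mul (t : ℕ) (i j : Fin n) (a b : Fin n ⊕ Fin m) :
    Integrable (fun ω => S.Λ t ω i a * S.Λ t ω j b) P := by
  have h0 : Integrable (fun ω => S.Λ 0 ω i a * S.Λ 0 ω j b) P :=
    (S.memLp_param i a).integrable_mul (S.memLp_param j b)
  exact ((S.ident_param t).comp
    ((measurable_fromCols_apply i a).mul (measurable_fromCols_apply j b))).integrable_iff.2 h0

/-- The second moments `E[Λ i a * Λ j b]`. -/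
noncomputable def lamMoment (i : Fin n) (a : Fin n ⊕ Fin m) (j : Fin n) (b : Fin n ⊕ Fin m) : ℝ :=
  ∫ ω, S.Λ 0 ω i a * S.Λ 0 ω j b ∂P

theorem lamMoment_comm (i j : Fin n) (a b : Fin n ⊕ Fin m) :
    S.lamMoment i a j b = S.lamMoment j b i a := by
  simp only [lamMoment, mul_comm]

theorem integral_Λ_mul (t : ℕ) (i j : Fin n) (a b : Fin n ⊕ Fin m) :
    ∫ ω, S.Λ t ω i a * S.Λ t ω j b ∂P = S.lamMoment i a j b :=
  ((S.ident_param t).comp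
    ((measurable_fromCols_apply i a).mul (measurable_fromCols_apply j b))).integral_eq

/-- The map `X ↦ E[Λ X Λᵀ]`. -/
noncomputable def phi : Matrix (Fin n ⊕ Fin m) (Fin n ⊕ Fin m) ℝ →ₗ[ℝ] Matrix (Fin n) (Fin n) ℝ where
  toFun X := Matrix.of fun i j => ∑ a, ∑ b, X a b * S.lamMoment i a j b
  map_add' X Y := by
    ext i j
    simp [add_mul, Finset.sum_add_distrib]
  map_smul' c X := by
    ext i j
    simp [-Fintype.sum_sum_type, Finset.mul_sum, mul_assoc]

/-- The map `P ↦ E[Λᵀ P Λ]`. -/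
noncomputable def phiAdj : Matrix (Fin n) (Fin n) ℝ →ₗ[ℝ] Matrix (Fin n ⊕ Fin m) (Fin n ⊕ Fin m) ℝ where
  toFun X := Matrix.of fun a b => ∑ i, ∑ j, X i j * S.lamMoment i a j b
  map_add' X Y := by
    ext i j
    simp [add_mul, Finset.sum_add_distrib]
  map_smul' c X := by
    ext i j
    simp [Finset.mul_sum, mul_assoc]

theorem phi_apply (X : Matrix (Fin n ⊕ Fin m) (Fin n ⊕ Fin m) ℝ) (i j : Fin n) :
    S.phi X i j = ∑ a, ∑ b, X a b * S.lamMoment i a j b := rfl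

theorem phiAdj_apply (X : Matrix (Fin n) (Fin n) ℝ) (a b : Fin n ⊕ Fin m) :
    S.phiAdj X a b = ∑ i, ∑ j, X i j * S.lamMoment i a j b := rfl

theorem trace_phiAdj_mul (W : Matrix (Fin n) (Fin n) ℝ)
    (X : Matrix (Fin n ⊕ Fin m) (Fin n ⊕ Fin m) ℝ) :
    (S.phiAdj W * X).trace = (W * S.phi X).trace := by
  simp only [Matrix.trace, Matrix.diag, Matrix.mul_apply, phi_apply, phiAdj_apply,
    Finset.sum_mul, Finset.mul_sum]
  calc ∑ a, ∑ b, ∑ i, ∑ j, W i j * S.lamMoment i a j b * X b a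
      = ∑ p : (Fin n ⊕ Fin m) × (Fin n ⊕ Fin m), ∑ q : Fin n × Fin n,
          W q.1 q.2 * S.lamMoment q.1 p.1 q.2 p.2 * X p.2 p.1 := by
        simp only [Fintype.sum_prod_type]
    _ = ∑ q : Fin n × Fin n, ∑ p : (Fin n ⊕ Fin m) × (Fin n ⊕ Fin m),
          W q.1 q.2 * S.lamMoment q.1 p.1 q.2 p.2 * X p.2 p.1 := Finset.sum_comm
    _ = ∑ i, ∑ j, ∑ a, ∑ b, W i j * S.lamMoment i a j b * X b a := by
        simp only [Fintype.sum_prod_type]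
    _ = _ := by
        refine Finset.sum_congr rfl fun i _ => Finset.sum_congr rfl fun j _ => ?_
        rw [Finset.sum_comm]
        refine Finset.sum_congr rfl fun b _ => Finset.sum_congr rfl fun a _ => ?_
        rw [S.lamMoment_comm]
        ring

theorem sandwich_apply (t : ℕ) (ω : Ω) (Z : Matrix (Fin n ⊕ Fin m) (Fin n ⊕ Fin m) ℝ)
    (i j : Fin n) : (S.Λ t ω * Z * (S.Λ t ω)ᵀ) i j =
      ∑ a, ∑ b, Z a b * (S.Λ t ω i a * S.Λ t ω j b) := by
  simp only [Matrix.mul_apply, Matrix.transpose_apply, Finset.sum_mul]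
  rw [Finset.sum_comm]
  refine Finset.sum_congr rfl fun a _ => Finset.sum_congr rfl fun b _ => ?_
  ring

/-- If `Z` is independent of the parameters at time `t`, then `E[Λ Z Λᵀ] = Φ(E[Z])`. -/
theorem integrable_sandwich_and_integral [IsProbabilityMeasure P] (t : ℕ)
    {Z : Ω → Matrix (Fin n ⊕ Fin m) (Fin n ⊕ Fin m) ℝ}
    (hZ : ∀ a b, Integrable (fun ω => Z ω a b) P)
    (hind : ∀ a b, IndepFun (fun ω => Z ω a b) (S.param t) P) (i j : Fin n) :
    Integrable (fun ω => (S.Λ t ω * Z ω * (S.Λ t ω)ᵀ) i j) P ∧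
      ∫ ω, (S.Λ t ω * Z ω * (S.Λ t ω)ᵀ) i j ∂P = S.phi (expect P Z) i j := by
  have hind' : ∀ a b, IndepFun (fun ω => Z ω a b) (fun ω => S.Λ t ω i a * S.Λ t ω j b) P :=
    fun a b => (hind a b).comp measurable_id
      ((measurable_fromCols_apply i a).mul (measurable_fromCols_apply j b))
  have hint : ∀ a b, Integrable (fun ω => Z ω a b * (S.Λ t ω i a * S.Λ t ω j b)) P :=
    fun a b => (hind' a b).integrable_mul (hZ a b) (S.integrable_Λ_mul t i j a b)
  simp only [sandwich_apply]
  refine ⟨integrable_finsetSum _ fun a _ => integrable_finsetSum _ fun b _ => hint a b, ?_⟩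
  rw [integral_finsetSum _ fun a _ => integrable_finsetSum _ fun b _ => hint a b, phi_apply]
  refine Finset.sum_congr rfl fun a _ => ?_
  rw [integral_finsetSum _ fun b _ => hint a b]
  refine Finset.sum_congr rfl fun b _ => ?_
  rw [(hind' a b).integral_fun_mul_eq_mul_integral (hZ a b).1
    (S.integrable_Λ_mul t i j a b).1, S.integral_Λ_mul]
  rfl

theorem integrable_sandwich_const [IsProbabilityMeasure P]
    (X : Matrix (Fin n ⊕ Fin m) (Fin n ⊕ Fin m) ℝ) (i j : Fin n) :
    Integrable (fun ω => (S.Λ 0 ω * X * (S.Λ 0 ω)ᵀ) i j) P :=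
  (S.integrable_sandwich_and_integral 0 (Z := fun _ => X) (fun _ _ => integrable_const _)
    (fun _ _ => indepFun_const_left _ _) i j).1

theorem phi_eq_expect [IsProbabilityMeasure P]
    (X : Matrix (Fin n ⊕ Fin m) (Fin n ⊕ Fin m) ℝ) :
    S.phi X = expect P fun ω => S.Λ 0 ω * X * (S.Λ 0 ω)ᵀ := by
  ext i j
  have h := (S.integrable_sandwich_and_integral 0 (Z := fun _ => X) (fun _ _ => integrable_const _)
    (fun _ _ => indepFun_const_left _ _) i j).2
  have hX : expect P (fun _ : Ω => X) = X := by
    ext a b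
    simp [expect]
  rw [hX] at h
  exact h.symm

theorem sandwichAdj_apply (ω : Ω) (W : Matrix (Fin n) (Fin n) ℝ) (a b : Fin n ⊕ Fin m) :
    ((S.Λ 0 ω)ᵀ * W * S.Λ 0 ω) a b = ∑ i, ∑ j, W i j * (S.Λ 0 ω i a * S.Λ 0 ω j b) := by
  simp only [Matrix.mul_apply, Matrix.transpose_apply, Finset.sum_mul]
  rw [Finset.sum_comm]
  refine Finset.sum_congr rfl fun a _ => Finset.sum_congr rfl fun b _ => ?_
  ring

theorem integrable_sandwichAdj (W : Matrix (Fin n) (Fin n) ℝ) (a b : Fin n ⊕ Fin m) :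
    Integrable (fun ω => ((S.Λ 0 ω)ᵀ * W * S.Λ 0 ω) a b) P := by
  simp only [sandwichAdj_apply]
  exact integrable_finsetSum _ fun i _ => integrable_finsetSum _ fun j _ =>
    (S.integrable_Λ_mul 0 i j a b).const_mul _

theorem phiAdj_eq_expect (W : Matrix (Fin n) (Fin n) ℝ) :
    S.phiAdj W = expect P fun ω => (S.Λ 0 ω)ᵀ * W * S.Λ 0 ω := by
  ext a b
  have hint : ∀ i j, Integrable (fun ω => W i j * (S.Λ 0 ω i a * S.Λ 0 ω j b)) P := fun i j =>
    (S.integrable_Λ_mul 0 i j a b).const_mul _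
  change _ = ∫ ω, ((S.Λ 0 ω)ᵀ * W * S.Λ 0 ω) a b ∂P
  simp only [sandwichAdj_apply, phiAdj_apply]
  rw [integral_finsetSum _ fun i _ => integrable_finsetSum _ fun j _ => hint i j]
  refine Finset.sum_congr rfl fun i _ => ?_
  rw [integral_finsetSum _ fun j _ => hint i j]
  refine Finset.sum_congr rfl fun j _ => ?_
  rw [integral_const_mul]
  rfl

theorem phi_nonneg [IsProbabilityMeasure P] {X : Matrix (Fin n ⊕ Fin m) (Fin n ⊕ Fin m) ℝ}
    (hX : 0 ≤ X) : 0 ≤ S.phi X := by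
  rw [phi_eq_expect]
  exact expect_nonneg (S.integrable_sandwich_const X) (ae_of_all _ fun ω => conj_nonneg hX _)

theorem phiAdj_nonneg {W : Matrix (Fin n) (Fin n) ℝ} (hW : 0 ≤ W) : 0 ≤ S.phiAdj W := by
  rw [phiAdj_eq_expect]
  exact expect_nonneg (S.integrable_sandwichAdj W)
    (ae_of_all _ fun ω => by simpa using conj_nonneg hW (S.Λ 0 ω)ᵀ)

theorem norm_B_le (ω : Ω) : ‖S.B 0 ω‖ ≤ ‖S.Λ 0 ω‖ := by
  refine norm_le_of_mulVec (norm_nonneg _) fun v => ?_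
  have h := mulVec_dotProduct_self_le (S.Λ 0 ω) (Sum.elim 0 v)
  simpa [Λ, Matrix.fromCols_mulVec_sumElim, sumElim_dotProduct_sumElim] using h

theorem integrable_norm_B_sq : Integrable (fun ω => ‖S.B 0 ω‖ ^ 2) P := by
  refine S.integrable_Λ.mono'
    ((measurable_norm_matrix.comp (S.measurable_param 0).snd.fst).pow_const 2).aestronglyMeasurable
    (ae_of_all _ fun ω => ?_)
  rw [Real.norm_of_nonneg (by positivity)]
  exact pow_le_pow_left₀ (norm_nonneg _) (S.norm_B_le ω) 2

theorem norm_R_le (ω : Ω) : ‖S.R 0 ω‖ ≤ ‖S.N 0 ω‖ := by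
  refine norm_le_of_mulVec (norm_nonneg _) fun v => ?_
  have h := mulVec_dotProduct_self_le (S.N 0 ω) (Sum.elim 0 v)
  simpa [N, Matrix.fromBlocks_mulVec, sumElim_dotProduct_sumElim] using h

theorem integrable_norm_R : Integrable (fun ω => ‖S.R 0 ω‖) P := by
  refine S.integrable_N.mono'
    (measurable_norm_matrix.comp (S.measurable_param 0).snd.snd.snd).aestronglyMeasurable
    (ae_of_all _ fun ω => ?_)
  rw [Real.norm_of_nonneg (by positivity)]
  exact S.norm_R_le ω

theorem integrable_N_apply (t : ℕ) (a b : Fin n ⊕ Fin m) :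
    Integrable (fun ω => S.N t ω a b) P := by
  have h0 : Integrable (fun ω => S.N 0 ω a b) P := by
    refine S.integrable_N.mono'
      ((measurable_fromBlocks_apply a b).comp (S.measurable_param 0)).aestronglyMeasurable
      (ae_of_all _ fun ω => ?_)
    exact abs_entry_le_norm _ a b
  exact ((S.ident_param t).comp (measurable_fromBlocks_apply a b)).integrable_iff.2 h0

theorem integral_N_apply (t : ℕ) (a b : Fin n ⊕ Fin m) :
    ∫ ω, S.N t ω a b ∂P = expect P (S.N 0) a b :=
  ((S.ident_param t).comp (measurable_fromBlocks_apply a b)).integral_eq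

theorem expect_N : expect P (S.N 0) =
    Matrix.fromBlocks (expect P (S.Q 0)) 0 0 (expect P (S.R 0)) := by
  ext (i | i) (j | j) <;> simp [expect, N]

theorem expect_Q_posDef (h : S.Assumption1) : (expect P (S.Q 0)).PosDef := by
  have h1 := h.1
  rw [expect_N] at h1
  exact h1.submatrix (e := Sum.inl) Sum.inl_injective

theorem expect_R_posDef (h : S.Assumption1) : (expect P (S.R 0)).PosDef := by
  have h1 := h.1
  rw [expect_N] at h1
  exact h1.submatrix (e := Sum.inr) Sum.inr_injective

/-- `Φ` applied to the projection onto the controls is `E[B Bᵀ]`. -/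
theorem phi_input_le [IsProbabilityMeasure P] :
    S.phi (Matrix.fromBlocks 0 0 0 1) ≤ (∫ ω, ‖S.B 0 ω‖ ^ 2 ∂P) • 1 := by
  rw [phi_eq_expect]
  have hBB : ∀ ω, S.Λ 0 ω *
      (Matrix.fromBlocks 0 0 0 1 : Matrix (Fin n ⊕ Fin m) (Fin n ⊕ Fin m) ℝ) *
      (S.Λ 0 ω)ᵀ = S.B 0 ω * (S.B 0 ω)ᵀ := by
    intro ω
    simp [Λ, Matrix.transpose_fromCols, Matrix.fromCols_mul_fromBlocks,
      Matrix.fromCols_mul_fromRows]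
  refine expect_le_smul_one (S.integrable_sandwich_const _) (ae_of_all _ fun ω => ?_)
    S.integrable_norm_B_sq fun ω v => ?_
  · rw [hBB]
    exact isSymm_of_nonneg (mul_transpose_nonneg _)
  · rw [hBB]
    have h := mulVec_dotProduct_self_le (S.B 0 ω)ᵀ v
    have h2 := Matrix.l2_opNorm_conjTranspose (S.B 0 ω)
    rw [Matrix.conjTranspose_eq_transpose_of_trivial] at h2
    rw [h2] at h
    have h3 := quadForm_conj (1 : Matrix (Fin m) (Fin m) ℝ) (S.B 0 ω)ᵀ v
    rw [Matrix.transpose_transpose, Matrix.mul_one, Matrix.one_mulVec] at h3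
    rw [h3]
    exact h

/-- The control block of `E[Λᵀ Λ]` is `E[Bᵀ B]`. -/
theorem phiAdj_input_le :
    (S.phiAdj 1).toBlocks₂₂ ≤ (∫ ω, ‖S.B 0 ω‖ ^ 2 ∂P) • 1 := by
  have hBB : ∀ ω (i j : Fin m), ((S.Λ 0 ω)ᵀ * (1 : Matrix (Fin n) (Fin n) ℝ) * S.Λ 0 ω)
      (Sum.inr i) (Sum.inr j) = ((S.B 0 ω)ᵀ * S.B 0 ω) i j := by
    intro ω i j
    simp [Λ, Matrix.mul_apply, Matrix.fromCols]
  have h1 : (S.phiAdj 1).toBlocks₂₂ = expect P fun ω => (S.B 0 ω)ᵀ * S.B 0 ω := by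
    ext i j
    rw [phiAdj_eq_expect]
    simp only [Matrix.toBlocks₂₂, expect, Matrix.of_apply, hBB]
  rw [h1]
  refine expect_le_smul_one (fun i j => ?_) (ae_of_all _ fun ω => ?_)
    S.integrable_norm_B_sq fun ω v => ?_
  · simpa only [hBB] using S.integrable_sandwichAdj 1 (Sum.inr i) (Sum.inr j)
  · exact isSymm_of_nonneg (transpose_mul_nonneg _)
  · have h3 := quadForm_conj (1 : Matrix (Fin n) (Fin n) ℝ) (S.B 0 ω) v
    rw [Matrix.mul_one, Matrix.one_mulVec] at h3
    rw [h3]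
    exact mulVec_dotProduct_self_le (S.B 0 ω) v

theorem expect_R_le : expect P (S.R 0) ≤ (∫ ω, ‖S.R 0 ω‖ ∂P) • 1 := by
  refine expect_le_smul_one
    (fun i j => S.integrable_N_apply 0 (Sum.inr i) (Sum.inr j)) ?_ S.integrable_norm_R
    fun ω v => quadForm_le_norm_mul _ v
  filter_upwards [S.posSemidef_N 0] with ω hω
  exact isSymm_of_nonneg (Matrix.nonneg_iff_posSemidef.2 (hω.submatrix (Sum.inr : Fin m → _)))

/-- The deterministic data of the problem. The bound on the second moment of `B` is enlarged by
one to make it positive. -/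
noncomputable def model [IsProbabilityMeasure P] (hn : 0 < n) (hm : 0 < m) (h₁ : S.Assumption1)
    (h₂ : S.Assumption2) : MomentModel (Fin n) (Fin m) where
  Φ := S.phi
  G := S.phiAdj
  Q := expect P (S.Q 0)
  R := expect P (S.R 0)
  X₀ := S.covInit
  sQ := S.sigmaQ
  sR := S.sigmaR
  mu := S.mu
  b := (∫ ω, ‖S.B 0 ω‖ ^ 2 ∂P) + 1
  r := ∫ ω, ‖S.R 0 ω‖ ∂P
  trace_G_mul := S.trace_phiAdj_mul
  Φ_nonneg _ hX := S.phi_nonneg hX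
  G_nonneg _ hX := S.phiAdj_nonneg hX
  sQ_pos := sigmaMin_pos hn (S.expect_Q_posDef h₁)
  sR_pos := sigmaMin_pos hm (S.expect_R_posDef h₁)
  mu_pos := sigmaMin_pos hn h₂
  b_pos := add_pos_of_nonneg_of_pos (integral_nonneg fun _ => by positivity) one_pos
  r_nonneg := integral_nonneg fun _ => norm_nonneg _
  sQ_le := sigmaMin_smul_one_le (S.expect_Q_posDef h₁).posSemidef
  sR_le := sigmaMin_smul_one_le (S.expect_R_posDef h₁).posSemidef
  R_le := S.expect_R_le
  mu_le := sigmaMin_smul_one_le h₂.posSemidef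
  Φ_input_le := S.phi_input_le.trans (smul_mono_scalar one_nonneg_matrix (by linarith))
  G_input_le := S.phiAdj_input_le.trans (smul_mono_scalar one_nonneg_matrix (by linarith))

end LQSystem
end

/-! ### Reduction of the random system to its second moments -/

section
open scoped MatrixOrder

namespace LQSystem

open MomentModel

variable {n m : ℕ} {Ω : Type*} [MeasurableSpace Ω] {P : Measure Ω} (S : LQSystem n m P)
  (L : Matrix (Fin m) (Fin n) ℝ)

/-- The state-control pair at time `t`. -/
def joint (t : ℕ) (ω : Ω) : Fin n ⊕ Fin m → ℝ := graph L *ᵥ S.state L t ω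

theorem sumElim_eq_joint (t : ℕ) (ω : Ω) :
    Sum.elim (S.state L t ω) (-(L *ᵥ S.state L t ω)) = S.joint L t ω := by
  simp [joint, graph, Matrix.fromRows_mulVec, Matrix.neg_mulVec]

theorem state_succ (t : ℕ) (ω : Ω) :
    S.state L (t + 1) ω = S.Λ t ω *ᵥ S.joint L t ω := by
  rw [← sumElim_eq_joint]
  rfl

theorem stageCost_eq (t : ℕ) (ω : Ω) :
    S.stageCost L t ω = S.joint L t ω ⬝ᵥ (S.N t ω *ᵥ S.joint L t ω) := by
  rw [← sumElim_eq_joint]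
  rfl

/-- The initial state and the parameters before time `T`. -/
def history (T : ℕ) (ω : Ω) : (Fin n → ℝ) × ((_ : Finset.range T) →
    Matrix (Fin n) (Fin n) ℝ × Matrix (Fin n) (Fin m) ℝ ×
      Matrix (Fin n) (Fin n) ℝ × Matrix (Fin m) (Fin m) ℝ) :=
  (S.x₀ ω, fun t => S.param t ω)

theorem measurable_history (T : ℕ) : Measurable (S.history T) :=
  S.measurable_x₀.prodMk (measurable_pi_lambda _ fun t => S.measurable_param t)

/-- The states up to time `T` are functions of the history. -/
theorem exists_state_eq (T t : ℕ) (ht : t ≤ T) :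
    ∃ g, Measurable g ∧ S.state L t = g ∘ S.history T := by
  induction t with
  | zero => exact ⟨Prod.fst, measurable_fst, rfl⟩
  | succ t ih =>
    obtain ⟨g, hg, hgs⟩ := ih (by omega)
    refine ⟨fun h => Matrix.fromCols (h.2 ⟨t, Finset.mem_range.2 ht⟩).1
      (h.2 ⟨t, Finset.mem_range.2 ht⟩).2.1 *ᵥ (graph L *ᵥ g h), ?_, ?_⟩
    · refine measurable_pi_lambda _ fun i => ?_
      simp only [Matrix.mulVec, dotProduct]
      refine Finset.measurable_sum _ fun a _ => Measurable.mul ?_ ?_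
      · exact (measurable_fromCols_apply i a).comp
          ((measurable_pi_apply (⟨t, Finset.mem_range.2 ht⟩ : Finset.range T)).comp
            measurable_snd)
      · exact Finset.measurable_sum _ fun k _ =>
          ((measurable_pi_apply k).comp hg).const_mul _
    · ext1 ω
      rw [state_succ, joint, hgs]
      rfl

/-- The parameters at time `T` are independent of the initial state and the earlier parameters. -/
theorem indepFun_history [IsProbabilityMeasure P] (T : ℕ) :
    IndepFun (S.history T) (S.param T) P := by
  refine indepFun_prodMk_of_indepFun S.measurable_x₀
    (measurable_pi_lambda _ fun t => S.measurable_param t) (S.measurable_param T) ?_ ?_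
  · refine S.indep_x₀.comp (φ := id) (ψ := fun p => (fun t : Finset.range T => p t, p T))
      measurable_id ?_
    exact (measurable_pi_lambda _ fun t => measurable_pi_apply _).prodMk (measurable_pi_apply T)
  · have h := S.indep_param.indepFun_finset (Finset.range T) {T} (by simp)
      (fun t => S.measurable_param t)
    have hψ : Measurable fun p : (_ : ({T} : Finset ℕ)) → Matrix (Fin n) (Fin n) ℝ ×
        Matrix (Fin n) (Fin m) ℝ × Matrix (Fin n) (Fin n) ℝ × Matrix (Fin m) (Fin m) ℝ =>
        p ⟨T, Finset.mem_singleton_self T⟩ := measurable_pi_apply _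
    exact h.comp measurable_id hψ

theorem indepFun_state [IsProbabilityMeasure P] (t : ℕ) :
    IndepFun (S.state L t) (S.param t) P := by
  obtain ⟨g, hg, h⟩ := S.exists_state_eq L t t le_rfl
  rw [h]
  exact (S.indepFun_history t).comp hg measurable_id

theorem indepFun_joint_mul [IsProbabilityMeasure P] (t : ℕ) (a b : Fin n ⊕ Fin m) :
    IndepFun (fun ω => S.joint L t ω a * S.joint L t ω b) (S.param t) P := by
  have hm : ∀ a, Measurable fun x : Fin n → ℝ => (graph L *ᵥ x) a := by
    intro a
    simp only [Matrix.mulVec, dotProduct]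
    exact Finset.measurable_sum _ fun k _ => (measurable_pi_apply k).const_mul _
  exact (S.indepFun_state L t).comp ((hm a).mul (hm b)) measurable_id

/-- The second moment matrix of the state at time `t`. -/
noncomputable def cov (t : ℕ) : Matrix (Fin n) (Fin n) ℝ :=
  expect P fun ω => Matrix.vecMulVec (S.state L t ω) (S.state L t ω)

theorem joint_mul_eq (t : ℕ) (ω : Ω) (a b : Fin n ⊕ Fin m) :
    S.joint L t ω a * S.joint L t ω b =
      ∑ k, ∑ l, graph L a k * graph L b l * (S.state L t ω k * S.state L t ω l) := by
  simp only [joint, Matrix.mulVec, dotProduct, Finset.sum_mul, Finset.mul_sum]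
  rw [Finset.sum_comm]
  refine Finset.sum_congr rfl fun k _ => Finset.sum_congr rfl fun l _ => ?_
  ring

theorem integrable_joint_mul (t : ℕ)
    (h : ∀ i j, Integrable (fun ω => S.state L t ω i * S.state L t ω j) P)
    (a b : Fin n ⊕ Fin m) : Integrable (fun ω => S.joint L t ω a * S.joint L t ω b) P := by
  simp only [joint_mul_eq]
  exact integrable_finsetSum _ fun k _ => integrable_finsetSum _ fun l _ => (h k l).const_mul _

theorem integral_joint_mul (t : ℕ)
    (h : ∀ i j, Integrable (fun ω => S.state L t ω i * S.state L t ω j) P)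
    (a b : Fin n ⊕ Fin m) : ∫ ω, S.joint L t ω a * S.joint L t ω b ∂P =
      (graph L * S.cov L t * (graph L)ᵀ) a b := by
  have hR : (graph L * S.cov L t * (graph L)ᵀ) a b = ∑ k, ∑ l, graph L a k * graph L b l *
      ∫ ω, S.state L t ω k * S.state L t ω l ∂P := by
    simp only [Matrix.mul_apply, Matrix.transpose_apply, Finset.sum_mul]
    rw [Finset.sum_comm]
    refine Finset.sum_congr rfl fun k _ => Finset.sum_congr rfl fun l _ => ?_
    simp only [cov, expect, Matrix.of_apply, Matrix.vecMulVec_apply]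
    ring
  rw [hR]
  simp only [joint_mul_eq]
  rw [integral_finsetSum _ fun k _ => integrable_finsetSum _ fun l _ => (h k l).const_mul _]
  refine Finset.sum_congr rfl fun k _ => ?_
  rw [integral_finsetSum _ fun l _ => (h k l).const_mul _]
  simp only [integral_const_mul]

theorem vecMulVec_state_succ (t : ℕ) (ω : Ω) :
    Matrix.vecMulVec (S.state L (t + 1) ω) (S.state L (t + 1) ω) =
      S.Λ t ω * Matrix.vecMulVec (S.joint L t ω) (S.joint L t ω) * (S.Λ t ω)ᵀ := by
  rw [state_succ, Matrix.mul_vecMulVec, Matrix.vecMulVec_mul, Matrix.vecMul_transpose]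

theorem integrable_state_mul [IsProbabilityMeasure P] (t : ℕ) (i j : Fin n) :
    Integrable (fun ω => S.state L t ω i * S.state L t ω j) P := by
  induction t generalizing i j with
  | zero =>
    have hm : ∀ i, Measurable fun ω => S.x₀ ω i := fun i =>
      (measurable_pi_apply i).comp S.measurable_x₀
    refine S.integrable_x₀.mono' ((hm i).mul (hm j)).aestronglyMeasurable (ae_of_all _ fun ω => ?_)
    have h := abs_apply_le_trace (Matrix.nonneg_iff_posSemidef.2
      (Matrix.posSemidef_vecMulVec_self_star (S.x₀ ω))) i j
    change |S.x₀ ω i * S.x₀ ω j| ≤ _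
    simpa [Matrix.trace_vecMulVec, Matrix.vecMulVec_apply] using h
  | succ t ih =>
    have h := (S.integrable_sandwich_and_integral t
      (Z := fun ω => Matrix.vecMulVec (S.joint L t ω) (S.joint L t ω))
      (S.integrable_joint_mul L t ih) (S.indepFun_joint_mul L t) i j).1
    simpa only [← vecMulVec_state_succ, Matrix.vecMulVec_apply] using h

variable [IsProbabilityMeasure P] (hn : 0 < n) (hm : 0 < m) (h₁ : S.Assumption1)
  (h₂ : S.Assumption2)

/-- The second moments of the state evolve by the linear map `F`. -/
theorem cov_eq (t : ℕ) :
    S.cov L t = ((S.model hn hm h₁ h₂).F L ^ t) (S.model hn hm h₁ h₂).X₀ := by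
  induction t with
  | zero => rfl
  | succ t ih =>
    rw [pow_succ', Module.End.mul_apply, ← ih, F_apply]
    ext i j
    have h := (S.integrable_sandwich_and_integral t
      (Z := fun ω => Matrix.vecMulVec (S.joint L t ω) (S.joint L t ω))
      (S.integrable_joint_mul L t (S.integrable_state_mul L t))
      (S.indepFun_joint_mul L t) i j).2
    have hZ : expect P (fun ω => Matrix.vecMulVec (S.joint L t ω) (S.joint L t ω)) =
        graph L * S.cov L t * (graph L)ᵀ := by
      ext a b
      exact S.integral_joint_mul L t (S.integrable_state_mul L t) a b
    rw [hZ] at h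
    simp only [← vecMulVec_state_succ] at h
    exact h

theorem cov_nonneg (t : ℕ) : 0 ≤ S.cov L t :=
  expect_nonneg (S.integrable_state_mul L t) (ae_of_all _ fun ω =>
    Matrix.nonneg_iff_posSemidef.2 (Matrix.posSemidef_vecMulVec_self_star (S.state L t ω)))

theorem integrable_state_dotProduct (t : ℕ) :
    Integrable (fun ω => S.state L t ω ⬝ᵥ S.state L t ω) P :=
  integrable_finsetSum _ fun i _ => S.integrable_state_mul L t i i

theorem integral_state_dotProduct (t : ℕ) :
    ∫ ω, S.state L t ω ⬝ᵥ S.state L t ω ∂P = (S.cov L t).trace := by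
  simp only [dotProduct]
  rw [integral_finsetSum _ fun i _ => S.integrable_state_mul L t i i]
  rfl

theorem integrable_stageCost_and_integral (t : ℕ) :
    Integrable (S.stageCost L t) P ∧
      ∫ ω, S.stageCost L t ω ∂P = (S.cov L t * (S.model hn hm h₁ h₂).costMat L).trace := by
  have hY := S.integrable_joint_mul L t (S.integrable_state_mul L t)
  have hind : ∀ a b, IndepFun (fun ω => S.joint L t ω a * S.joint L t ω b)
      (fun ω => S.N t ω a b) P := fun a b =>
    (S.indepFun_joint_mul L t a b).comp measurable_id (measurable_fromBlocks_apply a b)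
  have hint : ∀ a b, Integrable
      (fun ω => S.joint L t ω a * S.joint L t ω b * S.N t ω a b) P := fun a b =>
    (hind a b).integrable_mul (hY a b) (S.integrable_N_apply t a b)
  have hs : S.stageCost L t =
      fun ω => ∑ a, ∑ b, S.joint L t ω a * S.joint L t ω b * S.N t ω a b := by
    ext ω
    rw [stageCost_eq]
    simp only [dotProduct, Matrix.mulVec, Finset.mul_sum]
    refine Finset.sum_congr rfl fun a _ => Finset.sum_congr rfl fun b _ => ?_
    ring
  rw [hs]
  refine ⟨integrable_finsetSum _ fun a _ => integrable_finsetSum _ fun b _ => hint a b, ?_⟩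
  rw [integral_finsetSum _ fun a _ => integrable_finsetSum _ fun b _ => hint a b]
  have hN : (S.model hn hm h₁ h₂).N = expect P (S.N 0) := S.expect_N.symm
  have htr : (S.cov L t * (S.model hn hm h₁ h₂).costMat L).trace =
      ((graph L * S.cov L t * (graph L)ᵀ) * (expect P (S.N 0))ᵀ).trace := by
    have hsy : (expect P (S.N 0))ᵀ = expect P (S.N 0) := isSymm_of_nonneg
      (Matrix.nonneg_iff_posSemidef.2 h₁.1.posSemidef)
    rw [costMat, hN, hsy, Matrix.mul_assoc (graph L), Matrix.mul_assoc (graph L),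
      Matrix.trace_mul_comm (graph L)]
    simp only [Matrix.mul_assoc]
  rw [htr]
  simp only [Matrix.trace, Matrix.diag, Matrix.mul_apply (M := graph L * S.cov L t * (graph L)ᵀ),
    Matrix.transpose_apply (expect P (S.N 0))]
  refine Finset.sum_congr rfl fun a _ => ?_
  rw [integral_finsetSum _ fun b _ => hint a b]
  refine Finset.sum_congr rfl fun b _ => ?_
  rw [(hind a b).integral_fun_mul_eq_mul_integral (hY a b).1 (S.integrable_N_apply t a b).1,
    S.integral_joint_mul L t (S.integrable_state_mul L t), S.integral_N_apply]

theorem stageCost_nonneg (t : ℕ) : 0 ≤ᵐ[P] S.stageCost L t := by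
  filter_upwards [S.posSemidef_N t] with ω hω
  rw [stageCost_eq]
  exact (nonneg_iff_quadForm.1 (Matrix.nonneg_iff_posSemidef.2 hω)).2 _

theorem ecost_eq_tsum : S.ecost L =
    ∑' t, ENNReal.ofReal (S.cov L t * (S.model hn hm h₁ h₂).costMat L).trace := by
  have h := fun t => S.integrable_stageCost_and_integral L hn hm h₁ h₂ t
  rw [ecost, lintegral_tsum fun t => (h t).1.1.aemeasurable.ennreal_ofReal]
  refine tsum_congr fun t => ?_
  rw [← ofReal_integral_eq_lintegral_ofReal (h t).1 (S.stageCost_nonneg L t), (h t).2]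

variable {L} in
theorem ecost_eq (h : (S.model hn hm h₁ h₂).Stable L) :
    S.ecost L = ENNReal.ofReal ((S.model hn hm h₁ h₂).cost L) := by
  set D := S.model hn hm h₁ h₂ with hD
  have hsum := h.summable D.X₀_nonneg
  let φ : Matrix (Fin n) (Fin n) ℝ →ₗ[ℝ] ℝ :=
    Matrix.traceLinearMap (Fin n) ℝ ℝ ∘ₗ LinearMap.mulRight ℝ (D.costMat L)
  have hφ := (LinearMap.toContinuousLinearMap φ).hasSum hsum.hasSum
  have hφ' : HasSum (fun t => (S.cov L t * D.costMat L).trace) (D.cost L) := by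
    simp only [S.cov_eq L hn hm h₁ h₂]
    exact hφ
  rw [S.ecost_eq_tsum L hn hm h₁ h₂, ← ENNReal.ofReal_tsum_of_nonneg
    (fun t => trace_mul_nonneg (S.cov_nonneg L t) D.costMat_nonneg) hφ'.summable, hφ'.tsum_eq]

variable {L} in
theorem cost_eq (h : (S.model hn hm h₁ h₂).Stable L) :
    S.cost L = (S.model hn hm h₁ h₂).cost L := by
  rw [cost, S.ecost_eq hn hm h₁ h₂ h, ENNReal.toReal_ofReal h.cost_nonneg]

variable {L} in
theorem covAgg_eq (h : (S.model hn hm h₁ h₂).Stable L) :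
    S.covAgg L = (S.model hn hm h₁ h₂).sigma L := by
  set D := S.model hn hm h₁ h₂ with hD
  have hsum := h.summable D.X₀_nonneg
  ext i j
  have hbd : Summable fun t => ∫ ω, ‖S.state L t ω i * S.state L t ω j‖ ∂P := by
    refine Summable.of_nonneg_of_le (fun t => integral_nonneg fun ω => norm_nonneg _)
      (fun t => ?_) (h.summable_trace D.X₀_nonneg)
    rw [← S.cov_eq L hn hm h₁ h₂, ← integral_state_dotProduct]
    refine integral_mono (S.integrable_state_mul L t i j).norm
      (S.integrable_state_dotProduct L t) fun ω => ?_
    have h := abs_apply_le_trace (Matrix.nonneg_iff_posSemidef.2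
      (Matrix.posSemidef_vecMulVec_self_star (S.state L t ω))) i j
    simpa [Matrix.trace_vecMulVec, Matrix.vecMulVec_apply] using h
  have h1 := hasSum_integral_of_summable_integral_norm
    (fun t => S.integrable_state_mul L t i j) hbd
  have h2 : HasSum (fun t => S.cov L t i j) (D.sigma L i j) := by
    simp only [S.cov_eq L hn hm h₁ h₂]
    exact Pi.hasSum.1 (Pi.hasSum.1 hsum.hasSum i) j
  exact h1.unique h2

variable {L}

theorem coe_covOp_pow (t : ℕ) (X : symMat n) :
    (((S.covOp L ^ t) X : symMat n) : Matrix (Fin n) (Fin n) ℝ) =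
      ((S.model hn hm h₁ h₂).F L ^ t) X := by
  induction t with
  | zero => rfl
  | succ t ih =>
    rw [pow_succ', pow_succ', Module.End.mul_apply, Module.End.mul_apply, ← ih, F_apply]
    change expect P _ = S.phi _
    rw [phi_eq_expect]
    congr 1
    ext1 ω
    have hc : S.closedLoop L ω = S.Λ 0 ω * graph L := by
      simp [closedLoop, Λ, graph, Matrix.fromCols_mul_fromRows, sub_eq_add_neg]
    rw [hc, Matrix.transpose_mul]
    simp only [Matrix.mul_assoc]

theorem stable_of_admissible (h : L ∈ S.admissible) : (S.model hn hm h₁ h₂).Stable L := by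
  let b := Module.finBasis ℝ (symMat n)
  have hs := summable_toMatrix_pow_of_specRad_lt_one b (S.covOp L) h
  let e : symMat n := ⟨1, Matrix.isSymm_one⟩
  let φ : symMat n →ₗ[ℝ] ℝ := Matrix.traceLinearMap (Fin n) ℝ ℝ ∘ₗ (symMat n).subtype
  have hφ : ∀ t : ℕ, (((S.model hn hm h₁ h₂).F L ^ t) 1).trace =
      ∑ i, (∑ j, LinearMap.toMatrix b b (S.covOp L ^ t) i j * b.repr e j) * φ (b i) := by
    intro t
    have h1 : ((S.model hn hm h₁ h₂).F L ^ t) 1 = ((S.covOp L ^ t) e : symMat n) :=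
      (S.coe_covOp_pow hn hm h₁ h₂ t e).symm
    rw [h1]
    change φ ((S.covOp L ^ t) e) = _
    conv_lhs => rw [← b.sum_repr ((S.covOp L ^ t) e)]
    rw [map_sum]
    refine Finset.sum_congr rfl fun i _ => ?_
    rw [map_smul, smul_eq_mul, ← LinearMap.toMatrix_mulVec_repr b b]
    rfl
  unfold Stable
  simp only [hφ]
  exact summable_sum fun i _ => (summable_sum fun j _ => (hs i j).mul_right _).mul_right _

/-- If the second moments decay from the identity, they decay from every symmetric matrix, so the
spectral radius of the covariance operator is less than one. -/
theorem admissible_of_tendsto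
    (h : Tendsto (fun t : ℕ => (((S.model hn hm h₁ h₂).F L ^ t) 1).trace) atTop (𝓝 0)) :
    L ∈ S.admissible := by
  let b := Module.finBasis ℝ (symMat n)
  refine specRad_lt_one_of_tendsto b (S.covOp L) fun i j => ?_
  have h1 : Tendsto (fun t : ℕ => (S.covOp L ^ t) (b j)) atTop (𝓝 0) := by
    rw [tendsto_subtype_rng]
    simp only [S.coe_covOp_pow hn hm h₁ h₂]
    exact tendsto_F_pow_zero h (b j).2
  have h2 := ((b.coord i).continuous_of_finiteDimensional.tendsto 0).comp h1
  rw [map_zero] at h2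
  simpa [LinearMap.toMatrix_apply, Function.comp_def] using h2

theorem admissible_iff_stable : L ∈ S.admissible ↔ (S.model hn hm h₁ h₂).Stable L :=
  ⟨S.stable_of_admissible hn hm h₁ h₂,
    fun h => S.admissible_of_tendsto hn hm h₁ h₂ h.tendsto_atTop_zero⟩

/-- A mean-square stabilizing feedback is admissible. -/
theorem exists_admissible (hn : 0 < n) (hm : 0 < m) (h₁ : S.Assumption1)
    (h₂ : S.Assumption2) : ∃ L, L ∈ S.admissible := by
  obtain ⟨L, hL⟩ := h₁.2
  refine ⟨L, S.admissible_of_tendsto hn hm h₁ h₂ ?_⟩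
  set D := S.model hn hm h₁ h₂ with hD
  have h0 : Tendsto (fun t => (S.cov L t).trace) atTop (𝓝 0) := by
    have := (ENNReal.tendsto_toReal ENNReal.zero_ne_top).comp hL
    refine this.congr fun t => ?_
    rw [Function.comp_apply, ← ofReal_integral_eq_lintegral_ofReal
      (S.integrable_state_dotProduct L t) (ae_of_all _ fun ω => dotProduct_self_star_nonneg _),
      integral_state_dotProduct,
      ENNReal.toReal_ofReal (trace_nonneg_of_nonneg (S.cov_nonneg L t))]
  refine squeeze_zero
    (fun t => trace_nonneg_of_nonneg (D.F_pow_nonneg t one_nonneg_matrix)) (fun t => ?_)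
    (by simpa using h0.const_mul D.mu⁻¹)
  have h3 := trace_mono (D.F_pow_mono (L := L) t D.mu_le)
  rw [← S.cov_eq L hn hm h₁ h₂, map_smul, Matrix.trace_smul, smul_eq_mul] at h3
  rw [inv_mul_eq_div, le_div_iff₀' D.mu_pos]
  exact h3

end LQSystem
end

/-! ### Policy gradient iteration -/

section
open scoped MatrixOrder

namespace LQSystem

open MomentModel

variable {n m : ℕ} {Ω : Type*} [MeasurableSpace Ω] {P : Measure Ω} (S : LQSystem n m P)
  [IsProbabilityMeasure P] (hn : 0 < n) (hm : 0 < m) (h₁ : S.Assumption1)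
  (h₂ : S.Assumption2) {L : Matrix (Fin m) (Fin n) ℝ}

theorem hasFDerivAt_cost (h : (S.model hn hm h₁ h₂).Stable L) :
    HasFDerivAt S.cost (pairing ((S.model hn hm h₁ h₂).gradMat L)) L := by
  refine h.hasFDerivAt.congr_of_eventuallyEq ?_
  filter_upwards [h.eventually_stable] with L' h'
  exact S.cost_eq hn hm h₁ h₂ h'

theorem gradient_cost (h : (S.model hn hm h₁ h₂).Stable L) :
    gradient S.cost L = (S.model hn hm h₁ h₂).gradMat L := by
  ext i j
  rw [gradient, (S.hasFDerivAt_cost hn hm h₁ h₂ h).fderiv]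
  exact pairing_single _ i j

theorem isOptimal_iff : S.IsOptimal L ↔ (S.model hn hm h₁ h₂).Stable L ∧
    ∀ L', (S.model hn hm h₁ h₂).Stable L' →
      (S.model hn hm h₁ h₂).cost L ≤ (S.model hn hm h₁ h₂).cost L' := by
  simp only [IsOptimal, S.admissible_iff_stable hn hm h₁ h₂]
  refine and_congr_right fun h => forall₂_congr fun L' h' => ?_
  rw [S.cost_eq hn hm h₁ h₂ h, S.cost_eq hn hm h₁ h₂ h']

theorem existsUnique_isOptimal (hn : 0 < n) (hm : 0 < m) (h₁ : S.Assumption1)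
    (h₂ : S.Assumption2) : ∃! L, S.IsOptimal L := by
  obtain ⟨L₁, hL₁⟩ := S.exists_admissible hn hm h₁ h₂
  obtain ⟨L, hL, hmin⟩ := exists_minimizer (S.model hn hm h₁ h₂)
    ⟨L₁, S.stable_of_admissible hn hm h₁ h₂ hL₁⟩
  refine ⟨L, (S.isOptimal_iff hn hm h₁ h₂).2 ⟨hL, hmin⟩, fun L' hL' => ?_⟩
  replace hL' := (S.isOptimal_iff hn hm h₁ h₂).1 hL'
  have h := quadratic_growth hL hmin hL'.1
  refine eq_of_trace_sub_nonpos (nonpos_of_mul_nonpos_right (h.trans ?_)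
    (mul_pos (S.model hn hm h₁ h₂).mu_pos (S.model hn hm h₁ h₂).sR_pos))
  linarith [hL'.2 L hL]

theorem sigma_le_norm_covAgg (h : (S.model hn hm h₁ h₂).Stable L) :
    (S.model hn hm h₁ h₂).sigma L ≤ ‖S.covAgg L‖ • 1 := by
  rw [S.covAgg_eq hn hm h₁ h₂ h]
  exact le_smul_one_of_quadForm (isSymm_of_nonneg h.sigma_nonneg) fun v =>
    quadForm_le_norm_mul _ v

theorem norm_covAgg_pos (h : (S.model hn hm h₁ h₂).Stable L) : 0 < ‖S.covAgg L‖ := by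
  have h1 := trace_mono (h.mu_le_sigma.trans (S.sigma_le_norm_covAgg hn hm h₁ h₂ h))
  simp only [Matrix.trace_smul, Matrix.trace_one, Fintype.card_fin, smul_eq_mul] at h1
  have hn' : (0 : ℝ) < n := by exact_mod_cast hn
  exact (S.model hn hm h₁ h₂).mu_pos.trans_le (le_of_mul_le_mul_right h1 hn')

/-- For small step sizes the gradient iteration stays stable and the cost decreases by a multiple
of the squared gradient norm. -/
theorem gdIter_descent {η : ℝ} (hL : (S.model hn hm h₁ h₂).Stable L) (hη : 0 < η)
    (hη1 : η ≤ stepConst ((∫ ω, ‖S.B 0 ω‖ ^ 2 ∂P) + 1) (∫ ω, ‖S.R 0 ω‖ ∂P) S.sigmaQ S.mu *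
      (1 + S.cost L) ^ (-5 : ℤ)) (k : ℕ) :
    (S.model hn hm h₁ h₂).Stable (S.gdIter η L k) ∧
      (S.model hn hm h₁ h₂).cost (S.gdIter η L (k + 1)) -
        (S.model hn hm h₁ h₂).cost (S.gdIter η L k) ≤
          -(2 * η * (S.model hn hm h₁ h₂).gradSq (S.gdIter η L k)) := by
  have : Nonempty (Fin n) := ⟨⟨0, hn⟩⟩
  set D := S.model hn hm h₁ h₂ with hD
  have hstep : ∀ k, D.Stable (S.gdIter η L k) → D.cost (S.gdIter η L k) ≤ D.cost L →
      D.Stable (S.gdIter η L (k + 1)) ∧ D.cost (S.gdIter η L (k + 1)) -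
        D.cost (S.gdIter η L k) ≤ -(2 * η * D.gradSq (S.gdIter η L k)) := by
    intro k hk hc
    rw [S.cost_eq hn hm h₁ h₂ hL] at hη1
    rw [gdIter, S.gradient_cost hn hm h₁ h₂ hk]
    exact hk.descent_of_le_stepConst hc hη hη1
  have hinv : ∀ k, D.Stable (S.gdIter η L k) ∧ D.cost (S.gdIter η L k) ≤ D.cost L := by
    intro k
    induction k with
    | zero => exact ⟨hL, le_rfl⟩
    | succ k ih =>
      obtain ⟨h1, h2⟩ := hstep k ih.1 ih.2
      have h3 : 0 ≤ 2 * η * D.gradSq (S.gdIter η L k) := mul_nonneg (by positivity) gradSq_nonneg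
      exact ⟨h1, by linarith [ih.2]⟩
  exact ⟨(hinv k).1, (hstep k (hinv k).1 (hinv k).2).2⟩

end LQSystem
end

end RandLQ

theorem theorem1 :
    ∃ c : ℝ → ℝ → ℝ → ℝ → ℝ → ℝ → ℝ → ℝ,
      (∀ a b q r sq sr μ, 0 < c a b q r sq sr μ) ∧
      ∀ (n m : ℕ), 0 < n → 0 < m →
      ∀ (Ω : Type*) (_ : MeasurableSpace Ω) (P : Measure Ω) (_ : IsProbabilityMeasure P)
        (S : RandLQ.LQSystem n m P), S.Assumption1 → S.Assumption2 →
        -- the problem is well posed: finite differentiable cost, unique optimal policy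
        (∀ L ∈ S.admissible, S.ecost L ≠ ⊤ ∧ DifferentiableAt ℝ S.cost L) ∧
        (∃! Lstar, S.IsOptimal Lstar) ∧
        ∀ Lstar, S.IsOptimal Lstar →
        ∀ L₀ ∈ S.admissible, ∀ η : ℝ, 0 < η →
          η ≤ c (∫ ω, ‖S.A 0 ω‖ ^ 2 ∂P) (∫ ω, ‖S.B 0 ω‖ ^ 2 ∂P)
                (∫ ω, ‖S.Q 0 ω‖ ∂P) (∫ ω, ‖S.R 0 ω‖ ∂P) S.sigmaQ S.sigmaR S.mu
              * (1 + S.cost L₀) ^ (-5 : ℤ) →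
          (∀ k, S.gdIter η L₀ k ∈ S.admissible) ∧
          (∀ k, S.cost (S.gdIter η L₀ (k + 1)) - S.cost Lstar ≤
            (1 - 2 * η * (S.mu ^ 2 * S.sigmaR / ‖S.covAgg Lstar‖)) *
              (S.cost (S.gdIter η L₀ k) - S.cost Lstar)) ∧
          Tendsto (S.gdIter η L₀) atTop (𝓝 Lstar) ∧
          (∀ ε : ℝ, 0 < ε → ∀ k : ℕ, 1 ≤ k →
            ‖S.covAgg Lstar‖ / (2 * η * S.mu ^ 2 * S.sigmaR) *
              Real.log ((S.cost L₀ - S.cost Lstar) / ε) ≤ k →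
            S.cost (S.gdIter η L₀ k) - S.cost Lstar < ε) := by
  classical
  -- Outside the range of parameters that occur, the value of the constant is immaterial.
  refine ⟨fun _ b _ r sq _ μ => if 0 ≤ b ∧ 0 ≤ r ∧ 0 < sq ∧ 0 < μ then
    RandLQ.stepConst (b + 1) r sq μ else 1, fun a b q r sq sr μ => ?_, ?_⟩
  · dsimp only
    split_ifs with h
    · exact RandLQ.stepConst_pos (by linarith [h.1]) h.2.1 h.2.2.1 h.2.2.2
    · exact one_pos
  intro n m hn hm Ω _ P _ S h₁ h₂
  set D := S.model hn hm h₁ h₂ with hD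
  have hsQ : 0 < S.sigmaQ := D.sQ_pos
  have hsR : 0 < S.sigmaR := D.sR_pos
  have hmu : 0 < S.mu := D.mu_pos
  refine ⟨fun L hL => ?_, S.existsUnique_isOptimal hn hm h₁ h₂, ?_⟩
  · have h := S.stable_of_admissible hn hm h₁ h₂ hL
    refine ⟨?_, (S.hasFDerivAt_cost hn hm h₁ h₂ h).differentiableAt⟩
    rw [S.ecost_eq hn hm h₁ h₂ h]
    exact ENNReal.ofReal_ne_top
  intro Lstar hopt L₀ hL₀ η hη hη1
  beta_reduce at hη1
  rw [if_pos ⟨MeasureTheory.integral_nonneg fun _ => by positivity,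
    MeasureTheory.integral_nonneg fun _ => norm_nonneg _, hsQ, hmu⟩] at hη1
  have hL₀' := S.stable_of_admissible hn hm h₁ h₂ hL₀
  obtain ⟨hst, hmin⟩ := (S.isOptimal_iff hn hm h₁ h₂).1 hopt
  have hdesc := S.gdIter_descent hn hm h₁ h₂ hL₀' hη hη1
  have hσ := S.norm_covAgg_pos hn hm h₁ h₂ hst
  have hcost : ∀ k, S.cost (S.gdIter η L₀ k) = D.cost (S.gdIter η L₀ k) := fun k =>
    S.cost_eq hn hm h₁ h₂ (hdesc k).1
  have hcs : S.cost Lstar = D.cost Lstar := S.cost_eq hn hm h₁ h₂ hst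
  set a := 2 * η * (S.mu ^ 2 * S.sigmaR / ‖S.covAgg Lstar‖) with ha
  have ha0 : 0 < a := by positivity
  set e : ℕ → ℝ := fun k => S.cost (S.gdIter η L₀ k) - S.cost Lstar with he
  have he0 : ∀ k, 0 ≤ e k := fun k => by
    simp only [he, hcost, hcs]
    exact sub_nonneg.2 (hmin _ (hdesc k).1)
  have hcontr : ∀ k, e (k + 1) ≤ (1 - a) * e k := by
    intro k
    have h1 := (hdesc k).2
    have h2 := (hdesc k).1.gradient_dominated hst (S.sigma_le_norm_covAgg hn hm h₁ h₂ hst) hσ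
    have h3 := mul_le_mul_of_nonneg_left h2 (show 0 ≤ 2 * η by positivity)
    have h4 : 2 * η * (S.mu ^ 2 * S.sigmaR / ‖S.covAgg Lstar‖ *
        (D.cost (S.gdIter η L₀ k) - D.cost Lstar)) ≤ 2 * η * D.gradSq (S.gdIter η L₀ k) := h3
    simp only [he, hcost, hcs, ha]
    linarith
  refine ⟨fun k => (S.admissible_iff_stable hn hm h₁ h₂).2 (hdesc k).1, hcontr, ?_, ?_⟩
  · refine tendsto_pi_nhds.2 fun i => tendsto_pi_nhds.2 fun j => ?_
    rw [tendsto_iff_norm_sub_tendsto_zero]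
    have hlim : Tendsto (fun k => √(e k / (S.mu * S.sigmaR))) atTop (𝓝 0) := by
      have := (RandLQ.tendsto_zero_of_contraction he0 ha0 hcontr).div_const (S.mu * S.sigmaR)
      simpa [Function.comp_def] using (Real.continuous_sqrt.tendsto _).comp this
    refine squeeze_zero (fun k => norm_nonneg _) (fun k => ?_) hlim
    refine Real.abs_le_sqrt ?_
    rw [le_div_iff₀' (mul_pos hmu hsR)]
    refine (mul_le_mul_of_nonneg_left
      (RandLQ.sq_apply_le_trace (S.gdIter η L₀ k - Lstar) i j) (mul_pos hmu hsR).le).trans ?_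
    simp only [he, hcost, hcs]
    exact RandLQ.MomentModel.quadratic_growth hst hmin (hdesc k).1
  · intro ε hε k hk hlog
    refine RandLQ.lt_of_contraction he0 ha0 hcontr hε hk ?_
    have h1 := mul_le_mul_of_nonneg_left hlog ha0.le
    refine le_trans (le_of_eq ?_) h1
    have h2 : a * (‖S.covAgg Lstar‖ / (2 * η * S.mu ^ 2 * S.sigmaR)) = 1 := by
      rw [ha]
      field_simp
    rw [← mul_assoc, h2, one_mul]
    rfl
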